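/- Conventions. All ideals are closed and two-sided. For a $C^*$-algebra $A$ (not necessarily unital), let $\mathbb I(A)$ be the complete lattice of ideals of $A$ (ordered by inclusion; meets are intersections, the join of a family is the smallest ideal containing all its members). Let $\check A$ be the set of primitive ideals (kernels of non-zero irreducible $*$-representations on Hilbert spaces) with the hull-kernel topology, whose open subsets are exactly the sets $U_I=\{\mathfrak p\in\check A : I\not\subseteq\mathfrak p\}$, $I\in\mathbb I(A)$. Let $A,B$ be $C^*$-algebras and let $\varphi\colon A\to\mathcal M(B)$ be a $*$-homomorphism to the multiplier algebra of $B$. For $J\in\mathbb I(B)$ put $$r(J)=\{a\in A : \varphi(a)B+B\varphi(a)\subseteq J\},$$ and for $I\in\mathbb I(A)$ put $i(I)=\overline{\operatorname{span}}\{b_1\varphi(x)b_2 : b_1,b_2\in B,\ x\in I\}$. Let $\mathbb I^B(A)=r(\mathbb I(B))\subseteq\mathbb I(A)$ be the set of restricted ideals; it is closed under intersections, so it is a complete lattice. Let $\mathrm{Prime}^B(A)$ be the set of prime elements of $\mathbb I^B(A)$, that is, of those $\mathfrak p\in\mathbb I^B(A)$ with $\mathfrak p\ne A$ such that $I_1\cap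 I_2\subseteq\mathfrak p$ implies $I_1\subseteq\mathfrak p$ or $I_2\subseteq\mathfrak p$ for $I_1,I_2\in\mathbb I^B(A)$; its open subsets are the sets $\{\mathfrak p : I\not\subseteq\mathfrak p\}$ with $I\in\mathbb I^B(A)$. We say that $A$ separates ideals in $B$ if $r\colon\mathbb I(B)\to\mathbb I(A)$ is injective. Consider the conditions - (JR) the join in $\mathbb I(A)$ of any (possibly empty) family of restricted ideals is restricted; - (C1) $I\cap r(i(J))=r(i(I\cap J))$ for all $I\in\mathbb I^B(A)$ and $J\in\mathbb I(A)$. If (JR) holds, then for $\mathfrak p\in\check A$ let $\pi_0(\mathfrak p)\in\mathrm{Prime}^B(A)$ be the largest restricted ideal contained in $\mathfrak p$, and let the quasi-orbit space $\check A/{\sim}$ be the quotient of $\check A$, with the quotient topology, by the relation $\mathfrak p\sim\mathfrak q\iff\pi_0(\mathfrak p)=\pi_0(\mathfrak q)$. **Corollary 4.4.** Suppose that $\mathrm{Prime}^B(A)$ is first countable. There is a continuous open surjection $\pi\colon\check A\to\check B$ with $r=\pi^{-1}$, meaning $U_{r(J)}=\pi^{-1}(U_J)$ for all $J\in\mathbb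 I(B)$, if and only if $A$ separates ideals in $B$ and the conditions (JR) and (C1) hold. In that case $\check B\cong\mathrm{Prime}^B(A)\cong\check A/{\sim}$; more precisely, $\mathfrak q\mapsto r(\mathfrak q)$ is a homeomorphism from $\check B$ onto $\mathrm{Prime}^B(A)$, and $\pi_0$ induces a homeomorphism from $\check A/{\sim}$ onto $\mathrm{Prime}^B(A)$. -/

import Mathlib

open scoped MultiplierAlgebra

universe u v

/-! ### Closed two-sided ideals in a C*-algebra -/

/-- A closed two-sided ideal of a (not necessarily unital) C*-algebra. -/
structure ClosedIdeal (A : Type u) [NonUnitalCStarAlgebra A] extends Submodule ℂ A where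
  mul_mem_left' : ∀ (a : A) {x : A}, x ∈ carrier → a * x ∈ carrier
  mul_mem_right' : ∀ (a : A) {x : A}, x ∈ carrier → x * a ∈ carrier
  isClosed' : IsClosed carrier

namespace ClosedIdeal

section Lattice

variable {A : Type u} [NonUnitalCStarAlgebra A]

instance : SetLike (ClosedIdeal A) A where
  coe I := I.carrier
  coe_injective I J h := by
    obtain ⟨I, _, _, _⟩ := I
    obtain ⟨J, _, _, _⟩ := J
    obtain rfl : I = J := SetLike.coe_injective h
    rfl

/-- Ideals are ordered by inclusion. -/
instance : PartialOrder (ClosedIdeal A) := .ofSetLike (ClosedIdeal A) A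

instance : AddSubmonoidClass (ClosedIdeal A) A where
  zero_mem I := I.zero_mem'
  add_mem {I} := I.add_mem'

instance : SMulMemClass (ClosedIdeal A) ℂ A where
  smul_mem {I} c _ h := I.smul_mem' c h

theorem mul_left_mem (I : ClosedIdeal A) (a : A) {x : A} (h : x ∈ I) : a * x ∈ I :=
  I.mul_mem_left' a h

theorem mul_right_mem (I : ClosedIdeal A) (a : A) {x : A} (h : x ∈ I) : x * a ∈ I :=
  I.mul_mem_right' a h

theorem isClosed (I : ClosedIdeal A) : IsClosed (I : Set A) := I.isClosed'

/-- The meet of a family of ideals is its intersection. -/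
instance : InfSet (ClosedIdeal A) where
  sInf S :=
    { carrier := {x | ∀ I ∈ S, x ∈ I}
      zero_mem' := fun I _ => zero_mem I
      add_mem' := fun hx hy I hI => add_mem (hx I hI) (hy I hI)
      smul_mem' := fun c _ hx I hI => SMulMemClass.smul_mem c (hx I hI)
      mul_mem_left' := fun a _ hx I hI => I.mul_left_mem a (hx I hI)
      mul_mem_right' := fun a _ hx I hI => I.mul_right_mem a (hx I hI)
      isClosed' := by
        have : {x : A | ∀ I ∈ S, x ∈ I} = ⋂ I ∈ S, (I : Set A) := by ext; simp
        rw [this]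
        exact isClosed_biInter fun I _ => I.isClosed }

theorem mem_sInf {S : Set (ClosedIdeal A)} {x : A} : x ∈ sInf S ↔ ∀ I ∈ S, x ∈ I := Iff.rfl

/-- The complete lattice of closed two-sided ideals: meets are intersections and the join of a
family is the smallest closed ideal containing all its members. -/
instance : CompleteLattice (ClosedIdeal A) :=
  completeLatticeOfInf (ClosedIdeal A) fun _ =>
    ⟨fun I hI _ hx => mem_sInf.1 hx I hI, fun _ hK _ hx => mem_sInf.2 fun _ hI => hK hI hx⟩

theorem mem_inf {I J : ClosedIdeal A} {x : A} : x ∈ I ⊓ J ↔ x ∈ I ∧ x ∈ J := by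
  constructor
  · intro h
    exact ⟨(inf_le_left : I ⊓ J ≤ I) h, (inf_le_right : I ⊓ J ≤ J) h⟩
  · rintro ⟨hI, hJ⟩
    let K : ClosedIdeal A := sInf {I, J}
    have hK : K ≤ I ⊓ J := le_inf (sInf_le (by simp)) (sInf_le (by simp))
    exact hK (mem_sInf.2 (by simp [hI, hJ]))

theorem mem_top (x : A) : x ∈ (⊤ : ClosedIdeal A) := by
  let K : ClosedIdeal A := sInf ∅
  have hK : K ≤ ⊤ := le_top
  exact hK (mem_sInf.2 (by simp))

end Lattice

end ClosedIdeal

/-! ### Hull-kernel topologies -/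

section HullKernel

variable {L : Type u} [CompleteLattice L]

/-- The set `U_a = {p ∈ T | a ≰ p}`. -/
def coHull (T : Set L) (a : L) : Set T := {p | ¬ a ≤ p.1}

/-- The topology on a set `T` of prime elements of a complete lattice whose open subsets are
exactly the sets `U_a = {p ∈ T | a ≰ p}`. -/
@[reducible] def hullKernelTopology (T : Set L) (hT : ∀ p ∈ T, InfPrime p) : TopologicalSpace T where
  IsOpen s := ∃ a : L, s = coHull T a
  isOpen_univ := ⟨⊤, by
    ext p
    simpa [coHull, top_le_iff] using fun h : p.1 = ⊤ => (hT p.1 p.2).1 (h ▸ isMax_top)⟩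
  isOpen_inter := by
    rintro _ _ ⟨a, rfl⟩ ⟨b, rfl⟩
    refine ⟨a ⊓ b, ?_⟩
    ext p
    have := (hT p.1 p.2).inf_le (b := a) (c := b)
    simp only [coHull, Set.mem_inter_iff, Set.mem_ofPred_eq]
    tauto
  isOpen_sUnion := by
    intro S hS
    refine ⟨sSup {a | coHull T a ∈ S}, ?_⟩
    ext p
    simp only [coHull, Set.mem_sUnion, Set.mem_ofPred_eq, sSup_le_iff, not_forall]
    constructor
    · rintro ⟨s, hs, hp⟩
      obtain ⟨a, rfl⟩ := hS s hs
      exact ⟨a, hs, hp⟩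
    · rintro ⟨a, ha, hp⟩
      exact ⟨_, ha, hp⟩

/-- The space of (meet) prime elements of a complete lattice. The largest element is not prime, in
accordance with the description of prime elements through characters. -/
def PrimeSpace (L : Type u) [CompleteLattice L] : Type u := ({p : L | InfPrime p} : Set L)

instance : TopologicalSpace (PrimeSpace L) :=
  hullKernelTopology {p : L | InfPrime p} fun _ h => h

end HullKernel

/-! ### Primitive ideals -/

section Primitive

/-- A *-representation on a Hilbert space is (topologically) irreducible if it is non-zero and has
no closed invariant subspaces besides `0` and the whole space. -/
def IsIrreducibleRep {A : Type u} [NonUnitalCStarAlgebra A] {H : Type v} [NormedAddCommGroup H]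
    [InnerProductSpace ℂ H] [CompleteSpace H] (ρ : A →⋆ₙₐ[ℂ] (H →L[ℂ] H)) : Prop :=
  ρ ≠ 0 ∧ ∀ K : Submodule ℂ H, IsClosed (K : Set H) → (∀ a : A, ∀ ξ ∈ K, ρ a ξ ∈ K) →
    K = ⊥ ∨ K = ⊤

/-- An ideal is primitive if it is the kernel of an irreducible representation. (The Hilbert space
of an irreducible representation is a completed quotient of the algebra, so that nothing is lost by
the restriction on its universe.) -/
def IsPrimitive {A : Type u} [NonUnitalCStarAlgebra A] (P : ClosedIdeal A) : Prop :=
  ∃ (H : Type u) (_ : NormedAddCommGroup H) (_ : InnerProductSpace ℂ H) (_ : CompleteSpace H)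
    (ρ : A →⋆ₙₐ[ℂ] (H →L[ℂ] H)), IsIrreducibleRep ρ ∧ ∀ a : A, a ∈ P ↔ ρ a = 0

theorem IsPrimitive.infPrime {A : Type u} [NonUnitalCStarAlgebra A] {P : ClosedIdeal A}
    (hP : IsPrimitive P) : InfPrime P := by
  obtain ⟨H, _, _, _, ρ, ⟨h0, hirr⟩, hker⟩ := hP
  refine ⟨fun hmax => h0 ?_, fun b c hbc => ?_⟩
  · ext1 a
    exact (hker a).1 ((hmax.eq_top ▸ ClosedIdeal.mem_top a : a ∈ P))
  · let N : Submodule ℂ H :=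
      { carrier := {ξ | ∀ x ∈ c, ρ x ξ = 0}
        zero_mem' := by simp
        add_mem' := fun h1 h2 x hx => by rw [map_add, h1 x hx, h2 x hx, add_zero]
        smul_mem' := fun k ξ h x hx => by rw [map_smul, h x hx, smul_zero] }
    have hN : IsClosed (N : Set H) := by
      have : (N : Set H) = ⋂ x ∈ c, {ξ | ρ x ξ = 0} := by ext; simp [N]
      rw [this]
      exact isClosed_biInter fun x _ => isClosed_eq (ρ x).continuous continuous_const
    have hinv : ∀ a : A, ∀ ξ ∈ N, ρ a ξ ∈ N := by
      intro a ξ hξ x hx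
      have := hξ (x * a) (c.mul_right_mem a hx)
      rwa [map_mul] at this
    rcases hirr N hN hinv with h | h
    · left
      intro y hy
      rw [hker]
      ext ξ
      have hmem : ρ y ξ ∈ N := by
        intro x hx
        have h1 : x * y ∈ P :=
          hbc (ClosedIdeal.mem_inf.2 ⟨b.mul_left_mem x hy, c.mul_right_mem y hx⟩)
        have h2 := (hker _).1 h1
        rw [map_mul] at h2
        exact congrArg (fun T : H →L[ℂ] H => T ξ) h2
      rw [h] at hmem
      simpa using hmem
    · right
      intro x hx
      rw [hker]
      ext ξ
      have : ξ ∈ N := h ▸ Submodule.mem_top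
      simpa using this x hx

/-- The primitive ideal space of `A`. -/
def PrimitiveIdealSpace (A : Type u) [NonUnitalCStarAlgebra A] : Type u :=
  ({P : ClosedIdeal A | IsPrimitive P} : Set (ClosedIdeal A))

/-- The hull-kernel (Jacobson) topology on the primitive ideal space. -/
instance (A : Type u) [NonUnitalCStarAlgebra A] : TopologicalSpace (PrimitiveIdealSpace A) :=
  hullKernelTopology {P : ClosedIdeal A | IsPrimitive P} fun _ h => IsPrimitive.infPrime h

/-- The open subset of the primitive ideal space that corresponds to a closed ideal `I`: it
consists of the primitive ideals that do not contain `I`. -/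
def ClosedIdeal.toOpen {A : Type u} [NonUnitalCStarAlgebra A] (I : ClosedIdeal A) :
    Set (PrimitiveIdealSpace A) :=
  coHull {P : ClosedIdeal A | IsPrimitive P} I

end Primitive

/-! ### Restriction and induction of ideals -/

section Multiplier

variable {B : Type v} [NonUnitalCStarAlgebra B]

theorem eq_of_forall_mul_left_eq {y z : B} (h : ∀ x : B, x * y = x * z) : y = z := by
  have h1 : star (y - z) * (y - z) = 0 := by rw [mul_sub, h, sub_self]
  exact sub_eq_zero.1 (CStarRing.star_mul_self_eq_zero_iff _ |>.1 h1)

theorem eq_of_forall_mul_right_eq {y z : B} (h : ∀ x : B, y * x = z * x) : y = z := by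
  have h1 : (y - z) * star (y - z) = 0 := by rw [sub_mul, h, sub_self]
  exact sub_eq_zero.1 (CStarRing.mul_star_self_eq_zero_iff _ |>.1 h1)

theorem multiplier_fst_mul (m : 𝓜(ℂ, B)) (b c : B) : m.fst (b * c) = m.fst b * c :=
  eq_of_forall_mul_left_eq fun x => by
    rw [← m.central, ← mul_assoc, ← mul_assoc, m.central]

theorem multiplier_snd_mul (m : 𝓜(ℂ, B)) (b c : B) : m.snd (b * c) = b * m.snd c :=
  eq_of_forall_mul_right_eq fun x => by
    rw [m.central, mul_assoc, mul_assoc, m.central]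

theorem ClosedIdeal.multiplier_fst_mem (J : ClosedIdeal B) (m : 𝓜(ℂ, B)) {x : B} (hx : x ∈ J) :
    m.fst x ∈ J := by
  let _ := CStarAlgebra.spectralOrder B
  have _ := CStarAlgebra.spectralOrderedRing B
  have h := ((CStarAlgebra.increasingApproximateUnit B).tendsto_mul_right x)
  have h2 := (m.fst.continuous.tendsto x).comp h
  refine J.isClosed.mem_of_tendsto h2 (Filter.Eventually.of_forall fun e => ?_)
  simp only [Function.comp_apply, multiplier_fst_mul]
  exact J.mul_left_mem _ hx

theorem ClosedIdeal.multiplier_snd_mem (J : ClosedIdeal B) (m : 𝓜(ℂ, B)) {x : B} (hx : x ∈ J) :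
    m.snd x ∈ J := by
  let _ := CStarAlgebra.spectralOrder B
  have _ := CStarAlgebra.spectralOrderedRing B
  have h := ((CStarAlgebra.increasingApproximateUnit B).tendsto_mul_left x)
  have h2 := (m.snd.continuous.tendsto x).comp h
  refine J.isClosed.mem_of_tendsto h2 (Filter.Eventually.of_forall fun e => ?_)
  simp only [Function.comp_apply, multiplier_snd_mul]
  exact J.mul_right_mem _ hx

/-- The ideal `𝓜(B, J) = {m ∈ 𝓜(B) | m B + B m ⊆ J}` of the multiplier algebra. Here `m.fst b` is
the product `m b` and `m.snd b` is the product `b m`. -/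
def multiplierIdeal (J : ClosedIdeal B) : ClosedIdeal 𝓜(ℂ, B) where
  carrier := {m | ∀ b : B, m.fst b ∈ J ∧ m.snd b ∈ J}
  zero_mem' := fun b => by simp [zero_mem]
  add_mem' := fun h1 h2 b => by
    simpa using ⟨add_mem (h1 b).1 (h2 b).1, add_mem (h1 b).2 (h2 b).2⟩
  smul_mem' := fun c m h b => by
    simpa using ⟨SMulMemClass.smul_mem c (h b).1, SMulMemClass.smul_mem c (h b).2⟩
  mul_mem_left' := fun a m h b => by
    simpa using ⟨J.multiplier_fst_mem a (h b).1, (h _).2⟩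
  mul_mem_right' := fun a m h b => by
    simpa using ⟨(h _).1, J.multiplier_snd_mem a (h b).2⟩
  isClosed' := by
    have hf : ∀ b : B, Continuous fun m : 𝓜(ℂ, B) => m.fst b := fun b =>
      AddMonoidHomClass.continuous_of_bound
        (AddMonoidHom.mk' (fun m : 𝓜(ℂ, B) => m.fst b) fun _ _ => by simp) ‖b‖ fun m => by
          simpa [mul_comm] using m.fst.le_opNorm b
    have hs : ∀ b : B, Continuous fun m : 𝓜(ℂ, B) => m.snd b := fun b =>
      AddMonoidHomClass.continuous_of_bound
        (AddMonoidHom.mk' (fun m : 𝓜(ℂ, B) => m.snd b) fun _ _ => by simp) ‖b‖ fun m => by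
          simpa [mul_comm] using m.snd.le_opNorm b
    simp only [Set.ofPred_forall, Set.ofPred_and]
    exact isClosed_iInter fun b =>
      (J.isClosed.preimage (hf b)).inter (J.isClosed.preimage (hs b))

end Multiplier

section Galois

variable {A : Type u} {B : Type v} [NonUnitalCStarAlgebra A] [NonUnitalCStarAlgebra B]
variable (φ : A →⋆ₙₐ[ℂ] 𝓜(ℂ, B))

/-- The restriction `r(J) = φ⁻¹(𝓜(B, J))` of an ideal `J` of `B`. -/
def restrictIdeal (J : ClosedIdeal B) : ClosedIdeal A where
  carrier := {a | φ a ∈ multiplierIdeal J}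
  zero_mem' := by simp [zero_mem]
  add_mem' := fun h1 h2 => by simpa using add_mem h1 h2
  smul_mem' := fun c _ h => by simpa using SMulMemClass.smul_mem c h
  mul_mem_left' := fun a _ h => by simpa using (multiplierIdeal J).mul_left_mem (φ a) h
  mul_mem_right' := fun a _ h => by simpa using (multiplierIdeal J).mul_right_mem (φ a) h
  isClosed' := (multiplierIdeal J).isClosed.preimage
    (AddMonoidHomClass.continuous_of_bound φ 1 fun a => by
      simpa using NonUnitalStarAlgHom.norm_apply_le φ a)

/-- The induced ideal `i(I) = B φ(I) B`, the closed linear span of all products `b₁ φ(x) b₂` with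
`b₁, b₂ ∈ B` and `x ∈ I`. -/
def induceIdeal (I : ClosedIdeal A) : ClosedIdeal B where
  toSubmodule := (Submodule.span ℂ
    {y : B | ∃ b₁ b₂ : B, ∃ x ∈ I, y = b₁ * (φ x).fst b₂}).topologicalClosure
  mul_mem_left' := fun a y hy => by
    refine map_mem_closure (f := fun z => a * z) (by fun_prop) hy fun z hz => ?_
    refine Submodule.span_induction (p := fun z _ => a * z ∈ Submodule.span ℂ
      {y : B | ∃ b₁ b₂ : B, ∃ x ∈ I, y = b₁ * (φ x).fst b₂}) ?_ ?_ ?_ ?_ hz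
    · rintro _ ⟨b₁, b₂, x, hx, rfl⟩
      exact Submodule.subset_span ⟨a * b₁, b₂, x, hx, (mul_assoc _ _ _).symm⟩
    · simp
    · intro x y _ _ h1 h2
      rw [mul_add]
      exact add_mem h1 h2
    · intro c x _ h
      rw [mul_smul_comm]
      exact Submodule.smul_mem _ c h
  mul_mem_right' := fun a y hy => by
    refine map_mem_closure (f := fun z => z * a) (by fun_prop) hy fun z hz => ?_
    refine Submodule.span_induction (p := fun z _ => z * a ∈ Submodule.span ℂ
      {y : B | ∃ b₁ b₂ : B, ∃ x ∈ I, y = b₁ * (φ x).fst b₂}) ?_ ?_ ?_ ?_ hz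
    · rintro _ ⟨b₁, b₂, x, hx, rfl⟩
      exact Submodule.subset_span
        ⟨b₁, b₂ * a, x, hx, by rw [multiplier_fst_mul, mul_assoc]⟩
    · simp
    · intro x y _ _ h1 h2
      rw [add_mul]
      exact add_mem h1 h2
    · intro c x _ h
      rw [smul_mul_assoc]
      exact Submodule.smul_mem _ c h
  isClosed' := Submodule.isClosed_topologicalClosure _

/-- An ideal of `A` is restricted if it is of the form `r(J)` for an ideal `J` of `B`. -/
def IsRestricted (I : ClosedIdeal A) : Prop := ∃ J : ClosedIdeal B, I = restrictIdeal φ J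

/-- `A` separates ideals in `B`. -/
def SeparatesIdeals : Prop :=
  ∀ J₁ J₂ : ClosedIdeal B, restrictIdeal φ J₁ = restrictIdeal φ J₂ → J₁ = J₂

/-- Condition (JR): joins of (arbitrary, possibly empty) families of restricted ideals, formed in
the lattice of all ideals of `A`, are restricted. -/
def JoinsRestricted : Prop :=
  ∀ S : Set (ClosedIdeal A), (∀ I ∈ S, IsRestricted φ I) → IsRestricted φ (sSup S)

/-- Condition (C1): `I ∩ r(i(J)) = r(i(I ∩ J))` for all restricted ideals `I` and all ideals `J`
of `A`. -/
def ConditionC1 : Prop :=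
  ∀ I J : ClosedIdeal A, IsRestricted φ I →
    I ⊓ restrictIdeal φ (induceIdeal φ J) = restrictIdeal φ (induceIdeal φ (I ⊓ J))

/-- The partially ordered set of restricted ideals of `A`. -/
def RestrictedIdeal : Type u := {I : ClosedIdeal A // IsRestricted φ I}

instance : PartialOrder (RestrictedIdeal φ) :=
  inferInstanceAs (PartialOrder {I : ClosedIdeal A // IsRestricted φ I})

theorem isRestricted_sInf (S : Set (ClosedIdeal A)) (hS : ∀ I ∈ S, IsRestricted φ I) :
    IsRestricted φ (sInf S) := by
  refine ⟨sInf {J | restrictIdeal φ J ∈ S}, SetLike.ext fun a => ⟨fun ha b => ?_, fun ha => ?_⟩⟩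
  · exact ⟨ClosedIdeal.mem_sInf.2 fun J hJ => (ClosedIdeal.mem_sInf.1 ha _ hJ b).1,
      ClosedIdeal.mem_sInf.2 fun J hJ => (ClosedIdeal.mem_sInf.1 ha _ hJ b).2⟩
  · refine ClosedIdeal.mem_sInf.2 fun I hI => ?_
    obtain ⟨J, rfl⟩ := hS I hI
    exact fun b => ⟨ClosedIdeal.mem_sInf.1 (ha b).1 J hI, ClosedIdeal.mem_sInf.1 (ha b).2 J hI⟩

instance : InfSet (RestrictedIdeal φ) where
  sInf S := ⟨sInf (Subtype.val '' S),
    isRestricted_sInf φ _ (by rintro _ ⟨I, _, rfl⟩; exact I.2)⟩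

/-- The complete lattice of restricted ideals, ordered by inclusion. Its meets are intersections. -/
instance : CompleteLattice (RestrictedIdeal φ) :=
  completeLatticeOfInf (RestrictedIdeal φ) fun S =>
    ⟨fun I hI => (sInf_le ⟨I, hI, rfl⟩ : sInf (Subtype.val '' S) ≤ I.1),
      fun K hK => (le_sInf (by rintro _ ⟨I, hI, rfl⟩; exact hK hI) :
        K.1 ≤ sInf (Subtype.val '' S))⟩

/-- The space of prime elements in the lattice of restricted ideals. -/
abbrev RestrictedPrimeSpace : Type u := PrimeSpace (RestrictedIdeal φ)

theorem RestrictedIdeal.inf_val (I J : RestrictedIdeal φ) : (I ⊓ J).1 = I.1 ⊓ J.1 := by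
  refine le_antisymm (le_inf (inf_le_left : I ⊓ J ≤ I) (inf_le_right : I ⊓ J ≤ J)) ?_
  let K : RestrictedIdeal φ := sInf {I, J}
  have hK : K ≤ I ⊓ J := le_inf (sInf_le (by simp)) (sInf_le (by simp))
  refine le_trans (le_sInf ?_ : I.1 ⊓ J.1 ≤ K.1) hK
  rintro _ ⟨M, hM, rfl⟩
  rcases hM with rfl | rfl
  · exact inf_le_left
  · exact inf_le_right

variable {φ}

/-- Assume (JR). For a primitive ideal `P` of `A`, the largest restricted ideal contained in `P`. -/
def largestRestricted (hJR : JoinsRestricted φ) (P : PrimitiveIdealSpace A) :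
    RestrictedIdeal φ :=
  ⟨sSup {I | IsRestricted φ I ∧ I ≤ P.1}, hJR _ fun _ h => h.1⟩

theorem le_largestRestricted_iff (hJR : JoinsRestricted φ) (P : PrimitiveIdealSpace A)
    (I : RestrictedIdeal φ) : I ≤ largestRestricted hJR P ↔ I.1 ≤ P.1 :=
  ⟨fun h => le_trans (show I.1 ≤ (largestRestricted hJR P).1 from h) (sSup_le fun _ hI => hI.2),
    fun h => (le_sSup ⟨I.2, h⟩ : I.1 ≤ sSup {I | IsRestricted φ I ∧ I ≤ P.1})⟩

/-- Assume (JR). The canonical map from the primitive ideal space of `A` to the space of prime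
restricted ideals; it maps `P` to the largest restricted ideal contained in `P`. -/
def quasiOrbitProj (hJR : JoinsRestricted φ) (P : PrimitiveIdealSpace A) :
    RestrictedPrimeSpace φ :=
  ⟨largestRestricted hJR P, by
    refine ⟨fun hmax => ?_, fun I J hIJ => ?_⟩
    · let T : RestrictedIdeal φ := ⟨⊤, by simpa using isRestricted_sInf φ ∅ (by simp)⟩
      have htop : T ≤ largestRestricted hJR P := hmax.eq_top ▸ le_top
      have htop' : (⊤ : ClosedIdeal A) ≤ P.1 := (le_largestRestricted_iff hJR P T).1 htop
      exact (IsPrimitive.infPrime P.2).1 (top_le_iff.1 htop' ▸ isMax_top)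
    · rw [le_largestRestricted_iff, RestrictedIdeal.inf_val] at hIJ
      simpa only [le_largestRestricted_iff] using (IsPrimitive.infPrime P.2).inf_le.1 hIJ⟩

/-- Assume (JR). The quasi-orbit space: the quotient of the primitive ideal space of `A`, with the
quotient topology, by the relation that `P ∼ Q` if and only if the largest restricted ideals
contained in `P` and in `Q` coincide. -/
abbrev QuasiOrbitSpace (hJR : JoinsRestricted φ) : Type u :=
  Quotient (Setoid.ker (quasiOrbitProj hJR))

end Galois

/-! The assignment `I ↦ U_I` embeds the ideal lattice into the open sets of the primitive ideal
space, because every closed ideal is an intersection of primitive ideals. Given `π`, the three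
conditions are therefore set theory: surjectivity makes preimages injective, preimages commute with
unions, and openness forces `U_{i(I)} = π(U_I)`, so that (C1) becomes `π⁻¹(V) ∩ π⁻¹(π(W)) =
π⁻¹(π(π⁻¹(V) ∩ W))`.

For the converse, separation makes `r` an order isomorphism onto the restricted ideals, hence a
homeomorphism of prime spaces. Two further facts are needed: prime ideals of `B` are primitive, and
`π₀` is open and surjective. Both follow from the Baire property `exists_isPrimitive_of_essential`.
Take the ideals `I n` of a countable neighbourhood basis of a prime `p`. They are essential modulo
`p`: by primeness for `B`, and by (C1) together with primeness for `A`. A primitive ideal above `p`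
containing no `I n` then equals `p`, respectively is mapped to `p` by `π₀`.

The Baire property comes from states. Outside `P` one builds elements `d n` and `e n ≤ 1`, with `d
(n + 1) ∈ I n` and `e n` a local unit for all later `d m`. States killing `P` with value 1 at
finitely many `e n` exist by compression. Compactness gives one with value 1 at all of them, and an
extreme point of the set of such states has an irreducible GNS representation that kills `P` but no
`e n`. -/

/-! ### Functional calculus estimates modulo a closed ideal. -/

section Unital

variable {C : Type u} [CStarAlgebra C]

theorem ClosedIdeal.mem_of_forall_exists_norm_le {I : ClosedIdeal C} {d : C}
    (h : ∀ ε > 0, ∃ z ∈ I, ‖d - z‖ ^ 2 ≤ 2 * ε) : d ∈ I := by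
  have : d ∈ closure (I : Set C) := by
    refine Metric.mem_closure_iff.2 fun ε hε => ?_
    obtain ⟨z, hz, hd⟩ := h (ε ^ 2 / 4) (by positivity)
    refine ⟨z, hz, ?_⟩
    rw [dist_eq_norm]
    refine lt_of_pow_lt_pow_left₀ 2 hε.le ?_
    have : 0 < ε ^ 2 := by positivity
    linarith
  rwa [I.isClosed.closure_eq] at this

variable [PartialOrder C] [StarOrderedRing C]

/-- If `d⋆d ≤ i + ε` with `i` in a closed ideal, then `d` is close to that ideal. -/
theorem ClosedIdeal.exists_mem_norm_sub_sq_le (I : ClosedIdeal C) {d i : C} (hi : i ∈ I)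
    (hsa : IsSelfAdjoint i) {ε : ℝ} (hε : 0 < ε) (h : star d * d ≤ i + algebraMap ℝ C ε) :
    ∃ z ∈ I, ‖d - z‖ ^ 2 ≤ 2 * ε := by
  -- The function `1 - g` is divisible by `t`, so `1 - g(i)` lies in the ideal, while `g(t)² (t + ε)
  -- ≤ 2ε` for every real `t`, which bounds `‖d g(i)‖²`.
  set g : ℝ → ℝ := fun t => ε ^ 2 / (ε ^ 2 + t ^ 2) with hg
  have hpos : ∀ t : ℝ, ε ^ 2 + t ^ 2 ≠ 0 := fun t => by positivity
  have hgc : Continuous g := by rw [hg]; fun_prop (disch := assumption)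
  set k : ℝ → ℝ := fun t => t / (ε ^ 2 + t ^ 2) with hk
  have hkc : Continuous k := by rw [hk]; fun_prop (disch := assumption)
  have hv : IsSelfAdjoint (cfc g i) := cfc_predicate g i
  have hone : 1 - cfc g i = i * cfc k i := by
    have hmul : cfc (fun x => x * k x) i = i * cfc k i := by
      rw [cfc_mul (fun x => x) k i, cfc_id' ℝ i]
    rw [← hmul, ← cfc_const_one ℝ i, ← cfc_sub (fun _ => 1) g i]
    congr 1
    ext t
    have := hpos t
    simp only [hg, hk]
    field_simp
    ring
  refine ⟨d * (1 - cfc g i), I.mul_left_mem _ (hone ▸ I.mul_right_mem _ hi), ?_⟩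
  have h1 : d - d * (1 - cfc g i) = d * cfc g i := by rw [mul_sub, mul_one, sub_sub_cancel]
  rw [h1, sq, ← CStarRing.norm_star_mul_self]
  have h2 : star (d * cfc g i) * (d * cfc g i) = cfc g i * (star d * d) * cfc g i := by
    rw [star_mul, hv.star_eq]; simp only [mul_assoc]
  have h3 : cfc g i * (star d * d) * cfc g i ≤ algebraMap ℝ C (2 * ε) := by
    have := hv.conjugate_le_conjugate h
    refine this.trans ?_
    have h4 : cfc g i * (i + algebraMap ℝ C ε) * cfc g i
        = cfc (fun t => g t * (t + ε) * g t) i := by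
      rw [cfc_mul (fun t => g t * (t + ε)) g i, cfc_mul g (fun t => t + ε) i,
        cfc_add_const ε (fun x => x) i, cfc_id' ℝ i]
    rw [h4]
    refine cfc_le_algebraMap _ _ _ fun t _ => ?_
    have hp : 0 < ε ^ 2 + t ^ 2 := by positivity
    have g0 : 0 ≤ g t := by simp only [hg]; positivity
    have g1 : g t ≤ 1 := by
      simp only [hg]; rw [div_le_one hp]; nlinarith [sq_nonneg t]
    have g2 : g t * t ≤ ε := by
      simp only [hg]; rw [div_mul_eq_mul_div, div_le_iff₀ hp]
      nlinarith [mul_nonneg hε.le (sq_nonneg (ε - t)), mul_nonneg hε.le (sq_nonneg t),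
        mul_nonneg hε.le (sq_nonneg ε)]
    have g3 : g t * (t + ε) ≤ 2 * ε := by nlinarith
    calc g t * (t + ε) * g t ≤ (2 * ε) * g t := mul_le_mul_of_nonneg_right g3 g0
      _ ≤ 2 * ε := by nlinarith
  rw [h2]
  have hn : 0 ≤ cfc g i * (star d * d) * cfc g i := hv.conjugate_nonneg (star_mul_self_nonneg d)
  rwa [CStarAlgebra.norm_le_iff_le_algebraMap _ (by positivity) hn]

theorem ClosedIdeal.mem_of_star_mul_self_mem {I : ClosedIdeal C} {d : C} (h : star d * d ∈ I) :
    d ∈ I :=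
  I.mem_of_forall_exists_norm_le fun ε hε =>
    I.exists_mem_norm_sub_sq_le h (.star_mul_self d) hε (by
      simpa using algebraMap_nonneg C hε.le)

/-- Outside of a closed ideal, a positive element admits a truncation with a local unit. -/
theorem ClosedIdeal.exists_local_unit (I : ClosedIdeal C) {d : C} (hd : 0 ≤ d) (hdI : d ∉ I) :
    ∃ k c : C, d * k ≤ 1 ∧ d * k * c = c ∧ IsSelfAdjoint c ∧ c ∉ I := by
  have hsa : IsSelfAdjoint d := .of_nonneg hd
  -- The cut-offs `(d - δ)₊` converge to `d` as `δ → 0`, so they cannot all lie in the closed set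
  -- `I`. For such a `δ` take `k = max(δ, d)⁻¹`: then `d k` equals 1 on the part of the spectrum
  -- where the cut-off is non-zero.
  have h : ∃ δ : ℝ, 0 < δ ∧ cfc (fun t : ℝ => max (t - δ) 0) d ∉ I := by
    by_contra! hcon
    refine hdI (I.mem_of_forall_exists_norm_le fun ε hε => ?_)
    refine ⟨_, hcon (√ε) (Real.sqrt_pos.2 hε), ?_⟩
    have : ‖d - cfc (fun t : ℝ => max (t - √ε) 0) d‖ ≤ √ε := by
      nth_rewrite 1 [← cfc_id' ℝ d]
      rw [← cfc_sub (fun x => x) (fun t : ℝ => max (t - √ε) 0) d]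
      refine norm_cfc_le (Real.sqrt_nonneg _) fun t ht => ?_
      have ht0 : 0 ≤ t := spectrum_nonneg_of_nonneg hd ht
      rw [Real.norm_eq_abs, abs_le]
      rcases le_total (t - √ε) 0 with h | h
      · rw [max_eq_right h]; constructor <;> linarith [Real.sqrt_nonneg ε]
      · rw [max_eq_left h]; constructor <;> linarith [Real.sqrt_nonneg ε]
    calc _ ≤ √ε ^ 2 := by gcongr
      _ ≤ 2 * ε := by rw [Real.sq_sqrt hε.le]; linarith
  obtain ⟨δ, hδ, hc⟩ := h
  have hm : ∀ t : ℝ, 0 < max δ t := fun t => lt_max_of_lt_left hδ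
  have hm' : ∀ t : ℝ, max δ t ≠ 0 := fun t => (hm t).ne'
  have hkc : Continuous fun t : ℝ => (max δ t)⁻¹ := by fun_prop (disch := assumption)
  have he : d * cfc (fun t : ℝ => (max δ t)⁻¹) d = cfc (fun t : ℝ => t * (max δ t)⁻¹) d := by
    rw [cfc_mul (fun x => x) (fun t : ℝ => (max δ t)⁻¹) d continuousOn_id hkc.continuousOn,
      cfc_id' ℝ d]
  have hmc : Continuous fun t : ℝ => max (t - δ) 0 := by fun_prop
  have hec : Continuous fun t : ℝ => t * (max δ t)⁻¹ := continuous_id.mul hkc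
  refine ⟨cfc (fun t : ℝ => (max δ t)⁻¹) d, cfc (fun t : ℝ => max (t - δ) 0) d, ?_, ?_,
    cfc_predicate _ _, hc⟩
  · rw [he]
    refine cfc_le_one _ _ fun t _ => ?_
    rw [← div_eq_mul_inv, div_le_one (hm t)]
    exact le_max_right _ _
  · rw [he, ← cfc_mul (fun t : ℝ => t * (max δ t)⁻¹) (fun t : ℝ => max (t - δ) 0) d
      hec.continuousOn hmc.continuousOn]
    congr 1
    ext t
    rcases le_total t δ with h | h
    · rw [max_eq_right (sub_nonpos.2 h), mul_zero]
    · have : t ≠ 0 := (hδ.trans_le h).ne'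
      rw [max_eq_right h, mul_inv_cancel₀ this, one_mul]

end Unital

/-! ### Positive functionals and states modulo an ideal. -/

section Functionals

variable {C : Type u} [CStarAlgebra C] [PartialOrder C] [StarOrderedRing C]

open scoped ComplexOrder InnerProductSpace

theorem ClosedIdeal.star_mem {I : ClosedIdeal C} {x : C} (hx : x ∈ I) : star x ∈ I :=
  ClosedIdeal.mem_of_star_mul_self_mem (by simpa using I.mul_right_mem (star x) hx)

/-- Positive functionals that vanish on a closed ideal detect the elements outside of it. -/
theorem ClosedIdeal.exists_positive_functional (I : ClosedIdeal C) {d : C} (hd : d ∉ I) :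
    ∃ g : C →ₚ[ℂ] ℂ, (∀ x ∈ I, g x = 0) ∧ 0 < (g (star d * d)).re := by
  -- Imposing the bound on `x + star x` makes `S` a real cone in the complex space `C`. It contains
  -- `I`, all negative elements and all skew-adjoint ones, so a separating functional is forced to
  -- vanish on `I`, to be positive, and to be real on positive elements.
  let S : Set C := {x | ∃ i ∈ I, x + star x ≤ i}
  have hS0 : (0 : C) ∈ S := ⟨0, zero_mem I, by simp⟩
  have hsmul : ∀ t : ℝ, 0 ≤ t → ∀ x ∈ S, (t : ℂ) • x ∈ S := by
    rintro t ht x ⟨i, hi, h⟩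
    refine ⟨(t : ℂ) • i, SMulMemClass.smul_mem _ hi, ?_⟩
    have : (t : ℂ) • x + star ((t : ℂ) • x) = (t : ℂ) • (x + star x) := by simp [star_smul]
    rw [this]
    exact smul_le_smul_of_nonneg_left h (by exact_mod_cast ht)
  have hconv : Convex ℝ S := by
    intro x hx y hy a b ha hb _
    obtain ⟨i, hi, h1⟩ := hsmul a ha x hx
    obtain ⟨j, hj, h2⟩ := hsmul b hb y hy
    refine ⟨i + j, add_mem hi hj, ?_⟩
    have := add_le_add h1 h2
    simp only [Complex.coe_smul] at this
    rw [star_add]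
    refine le_of_eq_of_le ?_ this
    abel
  have hmem : star d * d ∉ closure S := by
    intro hcl
    refine hd (I.mem_of_forall_exists_norm_le fun ε hε => ?_)
    obtain ⟨x, ⟨i, hi, hxi⟩, hx⟩ := Metric.mem_closure_iff.1 hcl ε hε
    rw [dist_eq_norm] at hx
    set y := star d * d - x with hy
    have hys : IsSelfAdjoint (y + star y) := IsSelfAdjoint.add_star_self y
    have h1 : y + star y ≤ algebraMap ℝ C (2 * ε) := by
      refine hys.le_algebraMap_norm_self.trans ?_
      rw [← sub_nonneg, ← map_sub]
      refine algebraMap_nonneg C (sub_nonneg.2 ?_)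
      calc ‖y + star y‖ ≤ ‖y‖ + ‖star y‖ := norm_add_le _ _
        _ ≤ 2 * ε := by rw [norm_star]; linarith
    have hd2 : star d * d = (1 / 2 : ℝ) • ((x + star x) + (y + star y)) := by
      have : (x + star x) + (y + star y) = (2 : ℝ) • (star d * d) := by
        rw [two_smul, hy, star_sub, star_mul, star_star]; abel
      rw [this, smul_smul]; norm_num
    have hi2 : (1 / 2 : ℝ) • i ∈ I := by
      have := SMulMemClass.smul_mem ((1 / 2 : ℝ) : ℂ) hi
      rwa [Complex.coe_smul] at this
    have hle : star d * d ≤ (1 / 2 : ℝ) • i + algebraMap ℝ C ε := by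
      have h2 := smul_le_smul_of_nonneg_left (add_le_add hxi h1) (by norm_num : (0 : ℝ) ≤ 1 / 2)
      rw [← hd2, smul_add] at h2
      refine h2.trans (le_of_eq ?_)
      rw [Algebra.algebraMap_eq_smul_one, Algebra.algebraMap_eq_smul_one, smul_smul]
      congr 2
      ring
    refine I.exists_mem_norm_sub_sq_le hi2 ?_ hε hle
    have h3 := IsSelfAdjoint.of_nonneg (sub_nonneg.2 hle)
    have h4 : IsSelfAdjoint (algebraMap ℝ C ε) := .algebraMap _ (.all ε)
    have h5 := (h3.sub h4).add (.star_mul_self d)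
    convert h5 using 1
    abel
  obtain ⟨f, w, hfS, hfd⟩ := RCLike.geometric_hahn_banach_closed_point (𝕜 := ℂ) hconv.closure
    isClosed_closure hmem
  have hw : 0 < w := by simpa using hfS 0 (subset_closure hS0)
  -- A real functional bounded above on a cone is non-positive there: a positive value could be
  -- scaled up to exactly `w`.
  have hneg : ∀ x ∈ S, (f x).re ≤ 0 := by
    intro x hx
    by_contra! hpos
    have h1 := hfS _ (subset_closure (hsmul (w / (f x).re) (by positivity) x hx))
    rw [map_smul, smul_eq_mul] at h1
    simp only [RCLike.re_to_complex, Complex.re_ofReal_mul] at h1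
    rw [div_mul_cancel₀ _ hpos.ne'] at h1
    exact lt_irrefl _ h1
  have hI : ∀ x ∈ I, f x = 0 := by
    intro x hx
    have key : ∀ c : ℂ, (c * f x).re ≤ 0 := by
      intro c
      have hcx : c • x ∈ I := SMulMemClass.smul_mem c hx
      have := hneg (c • x) ⟨_, add_mem hcx (ClosedIdeal.star_mem hcx), le_rfl⟩
      simpa using this
    have := key ((starRingEnd ℂ) (f x))
    rw [← Complex.normSq_eq_conj_mul_self, Complex.ofReal_re] at this
    exact Complex.normSq_eq_zero.1 (le_antisymm this (Complex.normSq_nonneg _))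
  have hpos : ∀ x : C, 0 ≤ x → 0 ≤ f x := by
    intro x hx
    have hxs := (IsSelfAdjoint.of_nonneg hx).star_eq
    have h1 : (f (-x)).re ≤ 0 := hneg _ ⟨0, zero_mem I, by
      rw [star_neg, hxs, ← neg_add, neg_nonpos]; exact add_nonneg hx hx⟩
    have him : ∀ c : ℂ, star c = -c → (c * f x).re ≤ 0 := by
      intro c hc
      have := hneg (c • x) ⟨0, zero_mem I, by rw [star_smul, hxs, hc]; simp⟩
      simpa using this
    have h2 := him Complex.I (by simp)
    have h3 := him (-Complex.I) (by simp)
    simp at h1 h2 h3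
    rw [Complex.le_def]
    exact ⟨by simpa using h1, by simpa using le_antisymm h2 h3⟩
  refine ⟨PositiveLinearMap.mk₀ f.toLinearMap hpos, hI, hw.trans hfd⟩

/-- Cauchy–Schwarz in the pre-GNS space, where the class of 1 is a unit vector and left
multiplication by `x` has norm at most `‖x‖`. -/
theorem PositiveLinearMap.norm_apply_le_of_map_one (f : C →ₚ[ℂ] ℂ) (h1 : f 1 = 1) (x : C) :
    ‖f x‖ ≤ ‖x‖ := by
  have hone : ‖f.toPreGNS 1‖ = 1 := by rw [f.preGNS_norm_def]; simp [h1]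
  have hin : ⟪f.toPreGNS 1, f.toPreGNS x⟫_ℂ = f x := by rw [f.preGNS_inner_def]; simp
  have hx : ‖f.toPreGNS x‖ ≤ ‖x‖ := by
    have := (f.leftMulMapPreGNS x).le_opNorm (f.toPreGNS 1)
    have h2 : f.leftMulMapPreGNS x (f.toPreGNS 1) = f.toPreGNS x := by simp
    rw [h2, hone, mul_one] at this
    refine this.trans ?_
    exact LinearMap.mkContinuous_norm_le _ (norm_nonneg _) _
  have := norm_inner_le_norm (𝕜 := ℂ) (f.toPreGNS 1) (f.toPreGNS x)
  rw [hin, hone, one_mul] at this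
  exact this.trans hx

/-- The states that vanish on `I` and take the value `1` on all `e n`, as functions. -/
def stateFace (I : ClosedIdeal C) {ι : Type v} (e : ι → C) : Set (C → ℂ) :=
  {f | ∃ F : C →ₚ[ℂ] ℂ, ⇑F = f ∧ F 1 = 1 ∧ (∀ x ∈ I, F x = 0) ∧ ∀ n, F (e n) = 1}

/-- Banach–Alaoglu by hand: all defining conditions are pointwise closed, and states take values in
discs of radius `‖x‖`, so Tychonoff applies. -/
theorem isCompact_stateFace (I : ClosedIdeal C) {ι : Type v} (e : ι → C) :
    IsCompact (stateFace I e) := by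
  have heq : stateFace I e = {f | (∀ x y, f (x + y) = f x + f y) ∧ (∀ (c : ℂ) x, f (c • x) = c * f x)
      ∧ (∀ x, 0 ≤ x → 0 ≤ f x) ∧ f 1 = 1 ∧ (∀ x ∈ I, f x = 0) ∧ ∀ n, f (e n) = 1} := by
    ext f
    constructor
    · rintro ⟨F, rfl, h1, hI, he⟩
      exact ⟨map_add F, fun c x => by simp, fun x hx => F.map_nonneg hx, h1, hI, he⟩
    · rintro ⟨hadd, hsmul, hpos, h1, hI, he⟩
      exact ⟨PositiveLinearMap.mk₀ { toFun := f, map_add' := hadd, map_smul' := hsmul } hpos,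
        rfl, h1, hI, he⟩
  have hcl : IsClosed (stateFace I e) := by
    rw [heq]
    simp only [Set.ofPred_and, Set.ofPred_forall]
    have hev : ∀ x : C, Continuous fun f : C → ℂ => f x := fun x => continuous_apply x
    refine .inter (isClosed_iInter fun x => isClosed_iInter fun y =>
      isClosed_eq (hev _) ((hev _).add (hev _))) <| .inter (isClosed_iInter fun c =>
      isClosed_iInter fun x => isClosed_eq (hev _) (continuous_const.mul (hev _))) <| .inter
      (isClosed_iInter fun x => isClosed_iInter fun _ => isClosed_le continuous_const (hev _)) <|
      .inter (isClosed_eq (hev _) continuous_const) <| .inter (isClosed_iInter fun x =>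
      isClosed_iInter fun _ => isClosed_eq (hev _) continuous_const) <|
      isClosed_iInter fun n => isClosed_eq (hev _) continuous_const
  refine (isCompact_univ_pi fun x : C => isCompact_closedBall (0 : ℂ) ‖x‖).of_isClosed_subset hcl ?_
  rintro _ ⟨F, rfl, h1, -⟩ x -
  simpa using F.norm_apply_le_of_map_one h1 x

/-- The positive functional `a ↦ ⟪η, ρ a η⟫` of a representation. -/
noncomputable def vectorFunctional {H : Type v} [NormedAddCommGroup H] [InnerProductSpace ℂ H]
    [CompleteSpace H] (ρ : C →⋆ₐ[ℂ] (H →L[ℂ] H)) (η : H) : C →ₚ[ℂ] ℂ :=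
  .mk₀
    { toFun := fun a => ⟪η, ρ a η⟫_ℂ
      map_add' := fun a b => by simp
      map_smul' := fun c a => by simp } fun a ha => by
    obtain ⟨b, rfl⟩ := CStarAlgebra.nonneg_iff_eq_star_mul_self.1 ha
    simp only [LinearMap.coe_mk, AddHom.coe_mk, map_mul, map_star]
    rw [ContinuousLinearMap.star_eq_adjoint, mul_apply_eq_comp,
      ContinuousLinearMap.adjoint_inner_right, inner_self_eq_norm_sq_to_K]
    exact RCLike.ofReal_nonneg.2 (sq_nonneg ‖ρ b η‖) |>.trans_eq (by simp)

end Functionals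

/-! ### GNS representations and extreme points. -/

section PureStates

variable {C : Type u} [CStarAlgebra C] [PartialOrder C] [StarOrderedRing C]

open scoped ComplexOrder InnerProductSpace

theorem PositiveLinearMap.gnsStarAlgHom_toPreGNS_one (f : C →ₚ[ℂ] ℂ) (a : C) :
    f.gnsStarAlgHom a (f.toPreGNS 1 : f.GNS) = (f.toPreGNS a : f.GNS) := by
  have h : f.gnsStarAlgHom a = f.gnsNonUnitalStarAlgHom a := rfl
  rw [h, f.gnsNonUnitalStarAlgHom_apply_coe]
  simp

theorem PositiveLinearMap.inner_toPreGNS_one (f : C →ₚ[ℂ] ℂ) (a : C) :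
    ⟪(f.toPreGNS 1 : f.GNS), (f.toPreGNS a : f.GNS)⟫_ℂ = f a := by
  rw [UniformSpace.Completion.inner_coe, f.preGNS_inner_def]
  simp

theorem PositiveLinearMap.eq_top_of_forall_toPreGNS_mem (f : C →ₚ[ℂ] ℂ) {K : Submodule ℂ f.GNS}
    (hK : IsClosed (K : Set f.GNS)) (h : ∀ a : C, (f.toPreGNS a : f.GNS) ∈ K) : K = ⊤ := by
  refine Submodule.eq_top_iff'.2 fun x => ?_
  induction x using UniformSpace.Completion.induction_on with
  | hp => exact hK
  | ih a => exact h (f.ofPreGNS a)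

theorem PositiveLinearMap.gnsStarAlgHom_eq_zero (f : C →ₚ[ℂ] ℂ) {I : ClosedIdeal C}
    (hI : ∀ x ∈ I, f x = 0) {x : C} (hx : x ∈ I) : f.gnsStarAlgHom x = 0 := by
  ext y
  induction y using UniformSpace.Completion.induction_on with
  | hp => exact isClosed_eq (f.gnsStarAlgHom x).continuous continuous_const
  | ih a =>
    have h : f.gnsStarAlgHom x (a : f.GNS) = (f.toPreGNS (x * f.ofPreGNS a) : f.GNS) := by
      have h : f.gnsStarAlgHom x = f.gnsNonUnitalStarAlgHom x := rfl
      rw [h, f.gnsNonUnitalStarAlgHom_apply_coe]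
      simp
    have h2 : f (star (x * f.ofPreGNS a) * (x * f.ofPreGNS a)) = 0 :=
      hI _ (I.mul_left_mem _ (I.mul_right_mem _ hx))
    rw [h, _root_.zero_apply, ← norm_eq_zero, UniformSpace.Completion.norm_coe,
      f.preGNS_norm_def, f.ofPreGNS_toPreGNS, h2]
    simp

theorem inv_smul_vectorFunctional_mem_stateFace {H : Type v} [NormedAddCommGroup H]
    [InnerProductSpace ℂ H] [CompleteSpace H] (ρ : C →⋆ₐ[ℂ] (H →L[ℂ] H)) {I : ClosedIdeal C}
    (hI : ∀ x ∈ I, ρ x = 0) {ι : Type*} {e : ι → C} {η : H} (hη : η ≠ 0)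
    (he : ∀ n, ⟪η, ρ (e n) η⟫_ℂ = (‖η‖ ^ 2 : ℝ)) :
    (fun a => ((‖η‖ ^ 2)⁻¹ : ℝ) * ⟪η, ρ a η⟫_ℂ) ∈ stateFace I e := by
  have hη' : ((‖η‖ ^ 2 : ℝ) : ℂ) ≠ 0 := by
    exact_mod_cast pow_ne_zero 2 (norm_ne_zero_iff.2 hη)
  refine ⟨.mk₀ ((((‖η‖ ^ 2)⁻¹ : ℝ) : ℂ) • (vectorFunctional ρ η).toLinearMap) fun a ha =>
    mul_nonneg (RCLike.ofReal_nonneg.2 (inv_nonneg.2 (sq_nonneg _)))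
      ((vectorFunctional ρ η).map_nonneg ha),
    rfl, ?_, fun x hx => ?_, fun n => ?_⟩
  · change (((‖η‖ ^ 2)⁻¹ : ℝ) : ℂ) * ⟪η, ρ 1 η⟫_ℂ = 1
    rw [map_one, one_apply_eq_self, inner_self_eq_norm_sq_to_K, Complex.ofReal_inv]
    refine Eq.trans ?_ (inv_mul_cancel₀ hη')
    simp
  · change (((‖η‖ ^ 2)⁻¹ : ℝ) : ℂ) * ⟪η, ρ x η⟫_ℂ = 0
    rw [hI x hx]
    simp
  · change (((‖η‖ ^ 2)⁻¹ : ℝ) : ℂ) * ⟪η, ρ (e n) η⟫_ℂ = 1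
    rw [he, Complex.ofReal_inv, inv_mul_cancel₀ hη']

/-- An invariant subspace splits the cyclic vector as `ξ = η + ζ` and the state `f` into two vector
functionals. Because `e n ≤ 1`, the value 1 is maximal, so both normalised parts stay in `stateFace
I e`. Extremality makes the first equal to `f`, which forces `η` to be a multiple of `ξ`. -/
theorem eq_bot_or_eq_top_of_mem_extremePoints {I : ClosedIdeal C} {ι : Type*} {e : ι → C}
    (he : ∀ n, e n ≤ 1) (f : C →ₚ[ℂ] ℂ) (hf : ⇑f ∈ (stateFace I e).extremePoints ℝ)
    (K : Submodule ℂ f.GNS) (hK : IsClosed (K : Set f.GNS))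
    (hinv : ∀ a : C, ∀ ξ ∈ K, f.gnsStarAlgHom a ξ ∈ K) : K = ⊥ ∨ K = ⊤ := by
  obtain ⟨⟨F, hF, h1, hI, hen⟩, hext⟩ := mem_extremePoints.1 hf
  rw [DFunLike.coe_injective hF] at h1 hI hen
  set ρ := f.gnsStarAlgHom
  have hρI : ∀ x ∈ I, ρ x = 0 := fun x hx => f.gnsStarAlgHom_eq_zero hI hx
  have _ : CompleteSpace K := hK.completeSpace_coe
  set ξ : f.GNS := (f.toPreGNS 1 : f.GNS) with hξ
  have hρξ : ∀ a, ρ a ξ = (f.toPreGNS a : f.GNS) := f.gnsStarAlgHom_toPreGNS_one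
  have hfξ : ∀ a, ⟪ξ, ρ a ξ⟫_ℂ = f a := fun a => by rw [hρξ]; exact f.inner_toPreGNS_one a
  have hinv' : ∀ a : C, ∀ ζ ∈ Kᗮ, ρ a ζ ∈ Kᗮ := by
    intro a ζ hζ
    rw [Submodule.mem_orthogonal]
    intro y hy
    have := (Submodule.mem_orthogonal _ _).1 hζ _ (hinv (star a) y hy)
    rwa [map_star, ContinuousLinearMap.star_eq_adjoint,
      ContinuousLinearMap.adjoint_inner_left] at this
  have htop : ξ ∈ K → K = ⊤ := fun h =>
    f.eq_top_of_forall_toPreGNS_mem hK fun a => hρξ a ▸ hinv a ξ h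
  obtain ⟨η, hη, ζ, hζ, hsum⟩ := K.exists_add_mem_mem_orthogonal ξ
  have hsplit : ∀ a, f a = ⟪η, ρ a η⟫_ℂ + ⟪ζ, ρ a ζ⟫_ℂ := by
    intro a
    have h2 : ⟪η, ρ a ζ⟫_ℂ = 0 := (Submodule.mem_orthogonal _ _).1 (hinv' a ζ hζ) η hη
    have h3 : ⟪ζ, ρ a η⟫_ℂ = 0 := (Submodule.mem_orthogonal' _ _).1 hζ _ (hinv a η hη)
    rw [← hfξ, hsum, map_add, inner_add_left, inner_add_right, inner_add_right, h2, h3]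
    ring
  by_cases hη0 : η = 0
  · left
    have hξK : ξ ∈ Kᗮ := by rw [hsum, hη0, zero_add]; exact hζ
    have : Kᗮ = ⊤ := f.eq_top_of_forall_toPreGNS_mem K.isClosed_orthogonal fun a =>
      hρξ a ▸ hinv' a ξ hξK
    rwa [Submodule.orthogonal_eq_top_iff] at this
  by_cases hζ0 : ζ = 0
  · right
    exact htop (by rw [hsum, hζ0, add_zero]; exact hη)
  have hone : ∀ χ : f.GNS, ⟪χ, ρ 1 χ⟫_ℂ = (‖χ‖ ^ 2 : ℝ) := by
    intro χ
    rw [map_one, one_apply_eq_self, inner_self_eq_norm_sq_to_K]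
    simp
  have hle : ∀ χ : f.GNS, ∀ n, ⟪χ, ρ (e n) χ⟫_ℂ ≤ (‖χ‖ ^ 2 : ℝ) := fun χ n => by
    rw [← hone]
    exact OrderHomClass.mono (vectorFunctional ρ χ) (he n)
  have hadd : ((‖η‖ ^ 2 : ℝ) : ℂ) + (‖ζ‖ ^ 2 : ℝ) = 1 := by rw [← hone, ← hone, ← hsplit, h1]
  have heq : ∀ n, ⟪η, ρ (e n) η⟫_ℂ = (‖η‖ ^ 2 : ℝ) ∧ ⟪ζ, ρ (e n) ζ⟫_ℂ = (‖ζ‖ ^ 2 : ℝ) := by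
    intro n
    have h2 := hsplit (e n)
    rw [hen, ← hadd] at h2
    -- Two upper bounds whose sum is attained are attained separately.
    exact (add_eq_add_iff_eq_and_eq (hle η n) (hle ζ n)).1 h2.symm
  have hmη := inv_smul_vectorFunctional_mem_stateFace ρ hρI hη0 fun n => (heq n).1
  have hmζ := inv_smul_vectorFunctional_mem_stateFace ρ hρI hζ0 fun n => (heq n).2
  have hη2 : 0 < ‖η‖ ^ 2 := pow_pos (norm_pos_iff.2 hη0) 2
  have hζ2 : 0 < ‖ζ‖ ^ 2 := pow_pos (norm_pos_iff.2 hζ0) 2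
  have hex := (hext _ hmη _ hmζ ⟨‖η‖ ^ 2, ‖ζ‖ ^ 2, hη2, hζ2, by exact_mod_cast hadd, by
    ext a
    simp only [Pi.add_apply, Pi.smul_apply, Complex.real_smul]
    rw [← mul_assoc, ← mul_assoc, ← Complex.ofReal_mul, ← Complex.ofReal_mul,
      mul_inv_cancel₀ hη2.ne', mul_inv_cancel₀ hζ2.ne', hsplit]
    simp⟩).1
  -- The vectors `ρ a ξ` are dense, so this identity gives `η = ‖η‖² ξ`; hence `ξ ∈ K`.
  have hηξ : ∀ a, ⟪η, ρ a ξ⟫_ℂ = (‖η‖ ^ 2 : ℝ) * ⟪ξ, ρ a ξ⟫_ℂ := by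
    intro a
    have h2 : ⟪η, ρ a ζ⟫_ℂ = 0 := (Submodule.mem_orthogonal _ _).1 (hinv' a ζ hζ) η hη
    rw [hfξ, ← congrFun hex a, ← mul_assoc, ← Complex.ofReal_mul, mul_inv_cancel₀ hη2.ne', hsum,
      map_add, inner_add_right, h2]
    simp
  have hperp : ∀ x : f.GNS, ⟪η - ((‖η‖ ^ 2 : ℝ) : ℂ) • ξ, x⟫_ℂ = 0 := by
    intro x
    induction x using UniformSpace.Completion.induction_on with
    | hp => exact isClosed_eq (by fun_prop) continuous_const
    | ih a =>
      have := hηξ (f.ofPreGNS a)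
      rw [hρξ, f.toPreGNS_ofPreGNS] at this
      rw [inner_sub_left, inner_smul_left, this]
      simp
  have hηeq : η = ((‖η‖ ^ 2 : ℝ) : ℂ) • ξ := sub_eq_zero.1 (inner_self_eq_zero.1 (hperp _))
  right
  refine htop ?_
  have hne : ((‖η‖ ^ 2 : ℝ) : ℂ) ≠ 0 := by exact_mod_cast hη2.ne'
  have := K.smul_mem (((‖η‖ ^ 2 : ℝ) : ℂ)⁻¹) (hηeq ▸ hη)
  rwa [smul_smul, inv_mul_cancel₀ hne, one_smul] at this

/-- If for each `n` some state that vanishes on `I` takes the value `1` at `e k` for all `k < n`,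
then some irreducible representation vanishes on `I` but at none of the `e k`. -/
theorem exists_irreducible_of_states (I : ClosedIdeal C) {e : ℕ → C} (he : ∀ n, e n ≤ 1)
    (hst : ∀ n, (stateFace I fun k : Fin n => e k).Nonempty) :
    ∃ (H : Type u) (_ : NormedAddCommGroup H) (_ : InnerProductSpace ℂ H) (_ : CompleteSpace H)
      (ρ : C →⋆ₐ[ℂ] (H →L[ℂ] H)), (∀ x ∈ I, ρ x = 0) ∧ (∀ n, ρ (e n) ≠ 0) ∧
      ∀ K : Submodule ℂ H, IsClosed (K : Set H) → (∀ a : C, ∀ ξ ∈ K, ρ a ξ ∈ K) →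
        K = ⊥ ∨ K = ⊤ := by
  have hne : (stateFace I e).Nonempty := by
    obtain ⟨f, hf⟩ := IsCompact.nonempty_iInter_of_sequence_nonempty_isCompact_isClosed
      (fun n => stateFace I fun k : Fin n => e k) (fun n => by
        rintro f ⟨F, hF, h1, hI, hk⟩
        exact ⟨F, hF, h1, hI, fun k => hk k.castSucc⟩) hst (isCompact_stateFace _ _)
      fun n => (isCompact_stateFace _ _).isClosed
    rw [Set.mem_iInter] at hf
    obtain ⟨F, rfl, h1, hI, -⟩ := hf 0
    refine ⟨F, F, rfl, h1, hI, fun n => ?_⟩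
    -- The `n`-th set only constrains `e k` for `k < n`, so the value at `e n` is read off from the
    -- next one.
    obtain ⟨G, hG, -, -, hk⟩ := hf (n + 1)
    rw [← hG]
    exact hk ⟨n, n.lt_succ_self⟩
  obtain ⟨_, hf⟩ := (isCompact_stateFace I e).extremePoints_nonempty hne
  obtain ⟨f, rfl, h1, hI, hen⟩ := extremePoints_subset hf
  refine ⟨f.GNS, inferInstance, inferInstance, inferInstance, f.gnsStarAlgHom,
    fun x hx => f.gnsStarAlgHom_eq_zero hI hx, fun n h0 => ?_,
    eq_bot_or_eq_top_of_mem_extremePoints he f hf⟩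
  have h2 := f.inner_toPreGNS_one (e n)
  rw [← f.gnsStarAlgHom_toPreGNS_one (e n), h0, hen] at h2
  simp at h2

end PureStates

/-! ### The recursive construction of local units. -/

section SequenceUnital

variable {C : Type u} [CStarAlgebra C] [PartialOrder C] [StarOrderedRing C]

open scoped ComplexOrder

theorem stateFace_nonempty (I : ClosedIdeal C) {d : C} (hd : IsSelfAdjoint d) (hdI : d ∉ I)
    {ι : Type v} {e : ι → C} (he : ∀ n, e n * d = d) : (stateFace I e).Nonempty := by
  obtain ⟨g, hgI, hg⟩ := I.exists_positive_functional hdI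
  rw [hd.star_eq] at hg
  have h0 : 0 ≤ g (d * d) := g.map_nonneg (by simpa [hd.star_eq] using star_mul_self_nonneg d)
  have hne : g (d * d) ≠ 0 := fun h => by simp [h] at hg
  -- The compression `x ↦ g(d x d) / g(d²)` takes the value 1 at each `e n`, because `e n * d = d`.
  let L : C →ₗ[ℂ] ℂ :=
    { toFun := fun x => (g (d * d))⁻¹ * g (d * x * d)
      map_add' := fun x y => by rw [mul_add, add_mul, map_add, mul_add]
      map_smul' := fun c x => by
        rw [mul_smul_comm, smul_mul_assoc, map_smul, smul_eq_mul, RingHom.id_apply, smul_eq_mul]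
        ring }
  refine ⟨L, .mk₀ L fun x hx => mul_nonneg (inv_nonneg.2 h0)
    (g.map_nonneg (hd.conjugate_nonneg hx)), rfl, ?_, fun x hx => ?_, fun n => ?_⟩
  · change (g (d * d))⁻¹ * g (d * 1 * d) = 1
    rw [mul_one, inv_mul_cancel₀ hne]
  · change (g (d * d))⁻¹ * g (d * x * d) = 0
    rw [hgI _ (I.mul_right_mem _ (I.mul_left_mem _ hx)), mul_zero]
  · change (g (d * d))⁻¹ * g (d * e n * d) = 1
    rw [mul_assoc, he, inv_mul_cancel₀ hne]

/-- One step of the recursion. With `c` from `exists_local_unit`, the element `(cxc)⋆(cxc)` begins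
with `c`, so it inherits the local unit `d k`; the factor `x ∈ I` puts it into `I`. -/
theorem ClosedIdeal.exists_local_unit_step {P J I : ClosedIdeal C}
    (hI : ∀ c ∈ J, c ∉ P → ∃ x ∈ I, c * x * c ∉ P) (d : {d : C // 0 ≤ d ∧ d ∈ J ∧ d ∉ P}) :
    ∃ (d' : {d : C // 0 ≤ d ∧ d ∈ J ∧ d ∉ P}) (k : C),
      d.1 * k ≤ 1 ∧ d.1 * k * d'.1 = d'.1 ∧ d'.1 ∈ I := by
  obtain ⟨k, c, h1, hc, hcs, hcP⟩ := P.exists_local_unit d.2.1 d.2.2.2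
  have hcJ : c ∈ J := hc ▸ J.mul_right_mem _ (J.mul_right_mem _ d.2.2.1)
  obtain ⟨x, hx, hxP⟩ := hI c hcJ hcP
  have hy : c * x * c ∈ I := I.mul_right_mem _ (I.mul_left_mem _ hx)
  refine ⟨⟨star (c * x * c) * (c * x * c), star_mul_self_nonneg _,
    J.mul_left_mem _ (J.mul_left_mem _ hcJ), fun h => hxP (mem_of_star_mul_self_mem h)⟩, k, h1,
    ?_, I.mul_left_mem _ hy⟩
  simp only [star_mul, hcs.star_eq, ← mul_assoc]
  rw [hc]

theorem exists_irreducible_of_dense {P J : ClosedIdeal C} {I : ℕ → ClosedIdeal C} (hJ : ¬ J ≤ P)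
    (hI : ∀ n, ∀ c ∈ J, c ∉ P → ∃ x ∈ I n, c * x * c ∉ P) :
    ∃ (H : Type u) (_ : NormedAddCommGroup H) (_ : InnerProductSpace ℂ H) (_ : CompleteSpace H)
      (ρ : C →⋆ₐ[ℂ] (H →L[ℂ] H)), (∀ x ∈ P, ρ x = 0) ∧ (∃ x ∈ J, ρ x ≠ 0) ∧
      (∀ n, ∃ x ∈ I n, ρ x ≠ 0) ∧
      ∀ K : Submodule ℂ H, IsClosed (K : Set H) → (∀ a : C, ∀ ξ ∈ K, ρ a ξ ∈ K) →
        K = ⊥ ∨ K = ⊤ := by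
  obtain ⟨x, hxJ, hxP⟩ := SetLike.not_le_iff_exists.1 hJ
  let d₀ : {d : C // 0 ≤ d ∧ d ∈ J ∧ d ∉ P} := ⟨star x * x, star_mul_self_nonneg _,
    J.mul_left_mem _ hxJ, fun h => hxP (ClosedIdeal.mem_of_star_mul_self_mem h)⟩
  choose nxt k hk1 hk2 hk3 using fun n => ClosedIdeal.exists_local_unit_step (hI n)
  let d : ℕ → {d : C // 0 ≤ d ∧ d ∈ J ∧ d ∉ P} := fun n => Nat.rec d₀ (fun n y => nxt n y) n
  have hd : ∀ n, d (n + 1) = nxt n (d n) := fun _ => rfl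
  let e : ℕ → C := fun n => (d n).1 * k n (d n)
  have hed : ∀ n m, n < m → e n * (d m).1 = (d m).1 := by
    intro n m h
    induction m, h using Nat.le_induction with
    | base => exact hk2 n (d n)
    | succ m _ ih =>
      -- Since `e m` begins with `d m`, it is fixed by `e n`; and `d (m + 1)` is absorbed by `e m`.
      have h2 : (d (m + 1)).1 = e m * (d (m + 1)).1 := (hk2 m (d m)).symm
      have h3 : e n * e m = e m := by
        change e n * ((d m).1 * _) = _
        rw [← mul_assoc, ih]
      rw [h2, ← mul_assoc, h3]
  obtain ⟨H, i₁, i₂, i₃, ρ, hP, he, hirr⟩ := exists_irreducible_of_states P (e := e)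
    (fun n => hk1 n (d n)) fun n => stateFace_nonempty P (.of_nonneg (d n).2.1) (d n).2.2.2
      fun m => hed m n m.2
  exact ⟨H, i₁, i₂, i₃, ρ, hP, ⟨e 0, J.mul_right_mem _ (d 0).2.2.1, he 0⟩,
    -- The shift arises because `d (n + 1)`, the first factor of `e (n + 1)`, is the element chosen
    -- in `I n`.
    fun n => ⟨e (n + 1), (I n).mul_right_mem _ (hk3 n (d n)), he (n + 1)⟩, hirr⟩

end SequenceUnital

/-! ### Passage to the unitization and the Baire property. -/

section NonUnital

variable {A : Type u} [NonUnitalCStarAlgebra A]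

/-- A closed ideal of `A`, as a closed ideal of the unitization of `A`. -/
noncomputable def ClosedIdeal.unitization (I : ClosedIdeal A) : ClosedIdeal (Unitization ℂ A) where
  toSubmodule := I.toSubmodule.map (Unitization.inrHom ℂ ℂ A)
  mul_mem_left' := by
    rintro a _ ⟨x, hx, rfl⟩
    refine ⟨a.fst • x + a.snd * x, add_mem (I.smul_mem _ hx) (I.mul_left_mem _ hx), ?_⟩
    ext <;> simp
  mul_mem_right' := by
    rintro a _ ⟨x, hx, rfl⟩
    refine ⟨a.fst • x + x * a.snd, add_mem (I.smul_mem _ hx) (I.mul_right_mem _ hx), ?_⟩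
    ext <;> simp
  isClosed' := (Unitization.isometry_inr (𝕜 := ℂ) (A := A)).isClosedEmbedding.isClosedMap _ I.isClosed

theorem ClosedIdeal.mem_unitization {I : ClosedIdeal A} {x : Unitization ℂ A} :
    x ∈ I.unitization ↔ ∃ a ∈ I, (a : Unitization ℂ A) = x := Iff.rfl

theorem ClosedIdeal.inr_mem_unitization {I : ClosedIdeal A} {a : A} :
    (a : Unitization ℂ A) ∈ I.unitization ↔ a ∈ I := by
  rw [mem_unitization]
  refine ⟨?_, fun h => ⟨a, h, rfl⟩⟩
  rintro ⟨b, hb, h⟩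
  rwa [← Unitization.inr_injective h]

theorem ClosedIdeal.mem_of_star_mul_self_mem_nonUnital {I : ClosedIdeal A} {d : A} (h : star d * d ∈ I) :
    d ∈ I := by
  let _ := CStarAlgebra.spectralOrder (Unitization ℂ A)
  have _ := CStarAlgebra.spectralOrderedRing (Unitization ℂ A)
  rw [← inr_mem_unitization] at h ⊢
  rw [Unitization.inr_mul, Unitization.inr_star] at h
  exact mem_of_star_mul_self_mem h

/-- The closed ideal `{k | k x c ∈ P for all x ∈ I}`. -/
def ClosedIdeal.leftColon (P I : ClosedIdeal A) (c : A) : ClosedIdeal A where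
  carrier := {k | ∀ x ∈ I, k * x * c ∈ P}
  zero_mem' := fun x _ => by simp [zero_mem]
  add_mem' := fun h1 h2 x hx => by rw [add_mul, add_mul]; exact add_mem (h1 x hx) (h2 x hx)
  smul_mem' := fun t k h x hx => by
    rw [smul_mul_assoc, smul_mul_assoc]; exact SMulMemClass.smul_mem t (h x hx)
  mul_mem_left' := fun a k h x hx => by
    rw [mul_assoc a, mul_assoc a]; exact P.mul_left_mem a (h x hx)
  mul_mem_right' := fun a k h x hx => by
    rw [mul_assoc k]; exact h _ (I.mul_left_mem a hx)
  isClosed' := by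
    simp only [Set.ofPred_forall]
    exact isClosed_iInter fun x => isClosed_iInter fun _ => P.isClosed.preimage (by fun_prop)

/-- The closed ideal `{k | k' x k ∈ P for all k' ∈ K and x ∈ I}`. -/
def ClosedIdeal.rightColon (P I K : ClosedIdeal A) : ClosedIdeal A where
  carrier := {k | ∀ l ∈ K, ∀ x ∈ I, l * x * k ∈ P}
  zero_mem' := fun l _ x _ => by simp [zero_mem]
  add_mem' := fun h1 h2 l hl x hx => by
    rw [mul_add]; exact add_mem (h1 l hl x hx) (h2 l hl x hx)
  smul_mem' := fun t k h l hl x hx => by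
    rw [mul_smul_comm]; exact SMulMemClass.smul_mem t (h l hl x hx)
  mul_mem_left' := fun a k h l hl x hx => by
    rw [← mul_assoc, mul_assoc l]; exact h l hl _ (I.mul_right_mem a hx)
  mul_mem_right' := fun a k h l hl x hx => by
    rw [← mul_assoc]; exact P.mul_right_mem a (h l hl x hx)
  isClosed' := by
    simp only [Set.ofPred_forall]
    exact isClosed_iInter fun l => isClosed_iInter fun _ => isClosed_iInter fun x =>
      isClosed_iInter fun _ => P.isClosed.preimage (by fun_prop)

/-- Multiplying up to `(y⋆y)⁴` allows three successive extractions of a root: `(y⋆y)²`, then `y⋆y`,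
then `y`. -/
theorem ClosedIdeal.mem_of_mul_star_mul_self_mem {P : ClosedIdeal A} {y : A}
    (h : y * (star y * y * star y) * y ∈ P) : y ∈ P := by
  refine mem_of_star_mul_self_mem_nonUnital (mem_of_star_mul_self_mem_nonUnital (mem_of_star_mul_self_mem_nonUnital ?_))
  have : star (star (star y * y) * (star y * y)) * (star (star y * y) * (star y * y))
      = star y * (y * (star y * y * star y) * y) * (star y * y) := by
    simp only [star_mul, star_star, mul_assoc]
  rw [this]
  exact P.mul_right_mem _ (P.mul_left_mem _ h)

/-- If an ideal `I` is essential modulo `P`, then `c I c ⊈ P` for `c ∉ P`. -/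
theorem ClosedIdeal.exists_mul_mul_notMem {P I : ClosedIdeal A}
    (hI : ∀ K : ClosedIdeal A, ¬ K ≤ P → ¬ K ⊓ I ≤ P) {c : A} (hc : c ∉ P) :
    ∃ x ∈ I, c * x * c ∉ P := by
  by_contra! hcon
  -- If `c I c ⊆ P`, then `c` lies in both colon ideals, so `K` is not below `P`. Yet `y I y ⊆ P`
  -- for all `y ∈ K`, which forces `K ⊓ I ≤ P`.
  set K := P.leftColon I c ⊓ P.rightColon I (P.leftColon I c)
  have hcK : c ∈ K := mem_inf.2 ⟨hcon, fun l hl x hx => hl x hx⟩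
  refine hI K (fun h => hc (h hcK)) fun y hy => ?_
  obtain ⟨hyK, hyI⟩ := mem_inf.1 hy
  obtain ⟨h1, h2⟩ := mem_inf.1 hyK
  exact mem_of_mul_star_mul_self_mem
    (h2 y h1 (star y * y * star y) (I.mul_right_mem _ (I.mul_left_mem _ hyI)))

/-- The kernel of a representation, as a closed ideal. -/
def ClosedIdeal.ker {H : Type v} [NormedAddCommGroup H] [InnerProductSpace ℂ H]
    [CompleteSpace H] (ρ : A →⋆ₙₐ[ℂ] (H →L[ℂ] H)) : ClosedIdeal A where
  carrier := {a | ρ a = 0}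
  zero_mem' := map_zero ρ
  add_mem' := fun {a b} (ha : ρ a = 0) (hb : ρ b = 0) => by
    change ρ (a + b) = 0
    rw [map_add, ha, hb, add_zero]
  smul_mem' := fun c a (ha : ρ a = 0) => by
    change ρ (c • a) = 0
    rw [map_smul, ha, smul_zero]
  mul_mem_left' := fun a x (hx : ρ x = 0) => by
    change ρ (a * x) = 0
    rw [map_mul, hx, mul_zero]
  mul_mem_right' := fun a x (hx : ρ x = 0) => by
    change ρ (x * a) = 0
    rw [map_mul, hx, zero_mul]
  isClosed' := isClosed_eq (AddMonoidHomClass.continuous_of_bound ρ 1 fun a => by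
      simpa using NonUnitalStarAlgHom.norm_apply_le ρ a) continuous_const

/-- A Baire category property of the primitive ideal space: if the ideals `I n` are essential
modulo `P`, then any ideal not contained in `P` is outside of a primitive ideal above `P` that
contains none of the `I n`. -/
theorem exists_isPrimitive_of_essential {P J : ClosedIdeal A} {I : ℕ → ClosedIdeal A}
    (hJ : ¬ J ≤ P) (hI : ∀ n, ∀ K : ClosedIdeal A, ¬ K ≤ P → ¬ K ⊓ I n ≤ P) :
    ∃ Q, IsPrimitive Q ∧ P ≤ Q ∧ ¬ J ≤ Q ∧ ∀ n, ¬ I n ≤ Q := by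
  let _ := CStarAlgebra.spectralOrder (Unitization ℂ A)
  have _ := CStarAlgebra.spectralOrderedRing (Unitization ℂ A)
  obtain ⟨H, i₁, i₂, i₃, ρ, hP, ⟨x, hx, hx0⟩, hIn, hirr⟩ := exists_irreducible_of_dense
    (P := P.unitization) (J := J.unitization) (I := fun n => (I n).unitization)
    (fun h => hJ fun a ha => ClosedIdeal.inr_mem_unitization.1
      (h (ClosedIdeal.inr_mem_unitization.2 ha))) (by
      rintro n _ ⟨c, hc, rfl⟩ hcP
      obtain ⟨x, hx, hxc⟩ := ClosedIdeal.exists_mul_mul_notMem (hI n) (c := c) fun h =>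
        hcP (ClosedIdeal.inr_mem_unitization.2 h)
      refine ⟨x, ClosedIdeal.inr_mem_unitization.2 hx, fun h => hxc ?_⟩
      rw [← ClosedIdeal.inr_mem_unitization]
      simpa using h)
  let σ : A →⋆ₙₐ[ℂ] (H →L[ℂ] H) :=
    (ρ : Unitization ℂ A →⋆ₙₐ[ℂ] (H →L[ℂ] H)).comp (Unitization.inrNonUnitalStarAlgHom ℂ A)
  have hσ : ∀ a : A, σ a = ρ (a : Unitization ℂ A) := fun _ => rfl
  refine ⟨ClosedIdeal.ker σ, ⟨H, i₁, i₂, i₃, σ, ⟨fun h => ?_, fun K hK hinv => hirr K hK ?_⟩,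
    fun a => Iff.rfl⟩, fun a ha => hP _ (ClosedIdeal.inr_mem_unitization.2 ha), fun h => ?_,
    fun n h => ?_⟩
  · obtain ⟨a, -, rfl⟩ := hx
    exact hx0 (by change σ a = 0; rw [h]; rfl)
  · intro a ξ hξ
    -- The unitization acts through `σ` and scalars, so subspaces invariant under `A` are invariant
    -- under it too.
    have : ρ a ξ = a.fst • ξ + σ a.snd ξ := by
      conv_lhs => rw [← Unitization.inl_fst_add_inr_snd_eq a, map_add]
      rw [hσ, ← Unitization.algebraMap_eq_inl, AlgHomClass.commutes]
      simp [Algebra.algebraMap_eq_smul_one]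
    rw [this]
    exact K.add_mem (K.smul_mem _ hξ) (hinv _ _ hξ)
  · obtain ⟨a, ha, rfl⟩ := hx
    exact hx0 (h ha)
  · obtain ⟨_, ⟨a, ha, rfl⟩, ha0⟩ := hIn n
    exact ha0 (h ha)

end NonUnital

/-! ### Spaces of prime elements. -/

section Hull

variable {L : Type u} {M : Type v} [CompleteLattice L] [CompleteLattice M]

theorem PrimeSpace.exists_countable_nhds_basis [FirstCountableTopology (PrimeSpace L)]
    (p : PrimeSpace L) : ∃ a : ℕ → L, (∀ n, ¬ a n ≤ p.1) ∧
      ∀ b, ¬ b ≤ p.1 → ∃ n, ∀ q : PrimeSpace L, ¬ a n ≤ q.1 → ¬ b ≤ q.1 := by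
  obtain ⟨U, hU⟩ := (nhds p).exists_antitone_basis
  have h : ∀ n, ∃ a : L, ¬ a ≤ p.1 ∧ ∀ q : PrimeSpace L, ¬ a ≤ q.1 → q ∈ U n := by
    intro n
    obtain ⟨_, hsub, ⟨a, rfl⟩, hp⟩ := mem_nhds_iff.1 (hU.mem n)
    exact ⟨a, hp, fun q hq => hsub hq⟩
  choose a ha haU using h
  refine ⟨a, ha, fun b hb => ?_⟩
  have ho : IsOpen {q : PrimeSpace L | ¬ b ≤ q.1} := ⟨b, rfl⟩
  obtain ⟨n, hn⟩ := hU.mem_iff.1 (ho.mem_nhds hb)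
  exact ⟨n, fun q hq => hn (haU n q hq)⟩

theorem InfPrime.map_orderIso {p : L} (hp : InfPrime p) (E : L ≃o M) : InfPrime (E p) := by
  refine ⟨fun h => hp.1 fun a ha => ?_, fun b c h => ?_⟩
  · rw [← E.le_iff_le] at ha ⊢
    exact h ha
  · rw [← E.symm_apply_le, E.symm.map_inf] at h
    simpa only [E.symm_apply_le] using hp.2 h

/-- An order isomorphism induces a homeomorphism between spaces of prime elements. -/
def PrimeSpace.homeomorphOfOrderIso (E : L ≃o M) : PrimeSpace L ≃ₜ PrimeSpace M where
  toFun p := ⟨E p.1, p.2.map_orderIso E⟩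
  invFun q := ⟨E.symm q.1, q.2.map_orderIso E.symm⟩
  left_inv p := Subtype.ext (E.symm_apply_apply p.1)
  right_inv q := Subtype.ext (E.apply_symm_apply q.1)
  continuous_toFun := ⟨by
    rintro _ ⟨a, rfl⟩
    refine ⟨E.symm a, Set.ext fun p => not_congr ?_⟩
    exact (E.symm_apply_le).symm⟩
  continuous_invFun := ⟨by
    rintro _ ⟨a, rfl⟩
    refine ⟨E a, Set.ext fun p => not_congr ?_⟩
    exact (E.le_symm_apply)⟩

end Hull

/-! ### Ideals as open subsets of the primitive ideal space. -/

section PrimitiveSpace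

variable {A : Type u} [NonUnitalCStarAlgebra A]

theorem ClosedIdeal.mem_toOpen {I : ClosedIdeal A} {P : PrimitiveIdealSpace A} :
    P ∈ I.toOpen ↔ ¬ I ≤ P.1 := Iff.rfl

theorem ClosedIdeal.isOpen_toOpen (I : ClosedIdeal A) : IsOpen I.toOpen := ⟨I, rfl⟩

theorem PrimitiveIdealSpace.isOpen_iff {s : Set (PrimitiveIdealSpace A)} :
    IsOpen s ↔ ∃ I : ClosedIdeal A, s = I.toOpen := Iff.rfl

/-- Some primitive ideal contains `J` but not `I` unless `I ≤ J`. This is the Baire property with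
all auxiliary ideals equal to `⊤`, where essentiality is vacuous. -/
theorem ClosedIdeal.toOpen_subset_toOpen {I J : ClosedIdeal A} :
    I.toOpen ⊆ J.toOpen ↔ I ≤ J := by
  refine ⟨fun h => ?_, fun h P hI hJ => hI (h.trans hJ)⟩
  by_contra hIJ
  obtain ⟨Q, hQ, hJQ, hIQ, -⟩ := exists_isPrimitive_of_essential (I := fun _ => ⊤) hIJ
    fun _ K hK => by rwa [inf_top_eq]
  exact h (show (⟨Q, hQ⟩ : PrimitiveIdealSpace A) ∈ I.toOpen from hIQ) hJQ

theorem ClosedIdeal.toOpen_injective :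
    Function.Injective (ClosedIdeal.toOpen : ClosedIdeal A → Set (PrimitiveIdealSpace A)) :=
  fun _ _ h => le_antisymm (toOpen_subset_toOpen.1 h.subset) (toOpen_subset_toOpen.1 h.superset)

theorem ClosedIdeal.toOpen_inf (I J : ClosedIdeal A) : (I ⊓ J).toOpen = I.toOpen ∩ J.toOpen := by
  ext P
  rw [Set.mem_inter_iff, mem_toOpen, mem_toOpen, mem_toOpen, P.2.infPrime.inf_le, not_or]

theorem ClosedIdeal.toOpen_sSup (S : Set (ClosedIdeal A)) :
    (sSup S).toOpen = ⋃ I ∈ S, I.toOpen := by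
  ext P
  simp [mem_toOpen]

/-- Prime ideals are primitive if the space of prime ideals is first countable. -/
theorem InfPrime.isPrimitive [FirstCountableTopology (PrimeSpace (ClosedIdeal A))]
    {P : ClosedIdeal A} (hP : InfPrime P) : IsPrimitive P := by
  obtain ⟨I, hI, hbasis⟩ := PrimeSpace.exists_countable_nhds_basis
    (⟨P, hP⟩ : PrimeSpace (ClosedIdeal A))
  obtain ⟨Q, hQ, hPQ, -, hIQ⟩ := exists_isPrimitive_of_essential (P := P) (J := ⊤) (I := I)
    (fun h => hP.1 (top_le_iff.1 h ▸ isMax_top)) fun n K hK h => (hP.2 h).elim hK (hI n)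
  by_cases h : Q ≤ P
  · rwa [le_antisymm hPQ h]
  -- If `Q` were not below `P`, the primes not containing `Q` would form a neighbourhood of `P`,
  -- hence contain a basic one; but `Q` itself lies in every basic neighbourhood.
  · obtain ⟨n, hn⟩ := hbasis Q h
    exact absurd le_rfl (hn ⟨Q, hQ.infPrime⟩ (hIQ n))

end PrimitiveSpace

/-! ### Restriction, induction and the quasi-orbit map. -/

section RestrictInduce

variable {A : Type u} {B : Type v} [NonUnitalCStarAlgebra A] [NonUnitalCStarAlgebra B]
variable {φ : A →⋆ₙₐ[ℂ] 𝓜(ℂ, B)}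

theorem mem_restrictIdeal {J : ClosedIdeal B} {a : A} :
    a ∈ restrictIdeal φ J ↔ ∀ b : B, (φ a).fst b ∈ J ∧ (φ a).snd b ∈ J := Iff.rfl

theorem ClosedIdeal.mem_of_forall_mul_left_mem {J : ClosedIdeal B} {y : B}
    (h : ∀ b, b * y ∈ J) : y ∈ J := by
  let _ := CStarAlgebra.spectralOrder B
  have _ := CStarAlgebra.spectralOrderedRing B
  exact J.isClosed.mem_of_tendsto
    ((CStarAlgebra.increasingApproximateUnit B).tendsto_mul_right y)
    (Filter.Eventually.of_forall fun e => h e)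

theorem ClosedIdeal.mem_of_forall_mul_right_mem {J : ClosedIdeal B} {y : B}
    (h : ∀ b, y * b ∈ J) : y ∈ J := by
  let _ := CStarAlgebra.spectralOrder B
  have _ := CStarAlgebra.spectralOrderedRing B
  exact J.isClosed.mem_of_tendsto
    ((CStarAlgebra.increasingApproximateUnit B).tendsto_mul_left y)
    (Filter.Eventually.of_forall fun e => h e)

/-- Induction and restriction form a Galois connection. -/
theorem induceIdeal_le_iff {I : ClosedIdeal A} {J : ClosedIdeal B} :
    induceIdeal φ I ≤ J ↔ I ≤ restrictIdeal φ J := by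
  constructor
  · intro h x hx
    have key : ∀ b₁ b₂ : B, b₁ * (φ x).fst b₂ ∈ J := fun b₁ b₂ =>
      h (Submodule.le_topologicalClosure _ (Submodule.subset_span ⟨b₁, b₂, x, hx, rfl⟩))
    refine mem_restrictIdeal.2 fun b => ⟨ClosedIdeal.mem_of_forall_mul_left_mem fun c => key c b,
      ClosedIdeal.mem_of_forall_mul_right_mem fun c => ?_⟩
    rw [(φ x).central]
    exact key b c
  · intro h
    have h1 : Submodule.span ℂ {y : B | ∃ b₁ b₂ : B, ∃ x ∈ I, y = b₁ * (φ x).fst b₂}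
        ≤ J.toSubmodule := by
      refine Submodule.span_le.2 ?_
      rintro _ ⟨b₁, b₂, x, hx, rfl⟩
      exact J.mul_left_mem b₁ (mem_restrictIdeal.1 (h hx) b₂).1
    exact Submodule.topologicalClosure_minimal _ h1 J.isClosed

theorem restrictIdeal_mono {J₁ J₂ : ClosedIdeal B} (h : J₁ ≤ J₂) :
    restrictIdeal φ J₁ ≤ restrictIdeal φ J₂ := fun _ ha b => ⟨h (ha b).1, h (ha b).2⟩

theorem restrictIdeal_inf (J₁ J₂ : ClosedIdeal B) :
    restrictIdeal φ (J₁ ⊓ J₂) = restrictIdeal φ J₁ ⊓ restrictIdeal φ J₂ := by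
  refine le_antisymm (le_inf (restrictIdeal_mono inf_le_left) (restrictIdeal_mono inf_le_right)) ?_
  intro a ha b
  obtain ⟨h1, h2⟩ := ClosedIdeal.mem_inf.1 ha
  exact ⟨ClosedIdeal.mem_inf.2 ⟨(h1 b).1, (h2 b).1⟩, ClosedIdeal.mem_inf.2 ⟨(h1 b).2, (h2 b).2⟩⟩

theorem SeparatesIdeals.le_of_restrictIdeal_le (hs : SeparatesIdeals φ) {J₁ J₂ : ClosedIdeal B}
    (h : restrictIdeal φ J₁ ≤ restrictIdeal φ J₂) : J₁ ≤ J₂ := by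
  refine inf_eq_left.1 (hs _ _ ?_)
  rw [restrictIdeal_inf, inf_eq_left.2 h]

/-- If `A` separates ideals in `B`, then restriction is an order isomorphism onto the lattice of
restricted ideals. -/
noncomputable def SeparatesIdeals.orderIso (hs : SeparatesIdeals φ) :
    ClosedIdeal B ≃o RestrictedIdeal φ where
  toEquiv := Equiv.ofBijective (fun J => ⟨restrictIdeal φ J, J, rfl⟩)
    ⟨fun J₁ J₂ h => hs J₁ J₂ (congrArg Subtype.val h), by
      rintro ⟨_, J, rfl⟩
      exact ⟨J, rfl⟩⟩
  map_rel_iff' := ⟨fun h => hs.le_of_restrictIdeal_le h, fun h => restrictIdeal_mono h⟩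

/-- First countability is transported along `SeparatesIdeals.orderIso` to the prime ideals of `B`,
which are therefore all primitive. -/
theorem exists_homeomorph_restrictedPrimeSpace [FirstCountableTopology (RestrictedPrimeSpace φ)]
    (hs : SeparatesIdeals φ) : ∃ e : PrimitiveIdealSpace B ≃ₜ RestrictedPrimeSpace φ,
      ∀ Q : PrimitiveIdealSpace B, (e Q).1.1 = restrictIdeal φ Q.1 := by
  let E := PrimeSpace.homeomorphOfOrderIso hs.orderIso
  have : FirstCountableTopology (PrimeSpace (ClosedIdeal B)) :=
    E.isInducing.firstCountableTopology
  let F : PrimitiveIdealSpace B ≃ₜ PrimeSpace (ClosedIdeal B) :=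
    { toFun := fun Q => ⟨Q.1, Q.2.infPrime⟩
      invFun := fun Q => ⟨Q.1, Q.2.isPrimitive⟩
      left_inv := fun _ => rfl
      right_inv := fun _ => rfl
      continuous_toFun := ⟨by rintro _ ⟨I, rfl⟩; exact ⟨I, rfl⟩⟩
      continuous_invFun := ⟨by rintro _ ⟨I, rfl⟩; exact ⟨I, rfl⟩⟩ }
  exact ⟨F.trans E, fun Q => rfl⟩

theorem preimage_quasiOrbitProj (hJR : JoinsRestricted φ) (I : RestrictedIdeal φ) :
    quasiOrbitProj hJR ⁻¹' {p | ¬ I ≤ p.1} = I.1.toOpen :=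
  Set.ext fun P => not_congr (le_largestRestricted_iff hJR P I)

theorem continuous_quasiOrbitProj (hJR : JoinsRestricted φ) : Continuous (quasiOrbitProj hJR) :=
  ⟨by rintro _ ⟨I, rfl⟩; exact ⟨I.1, preimage_quasiOrbitProj hJR I⟩⟩

theorem le_restrictIdeal_induceIdeal (I : ClosedIdeal A) :
    I ≤ restrictIdeal φ (induceIdeal φ I) := induceIdeal_le_iff.1 le_rfl

theorem restrictIdeal_induceIdeal_le {I K : ClosedIdeal A} (hK : IsRestricted φ K) (h : I ≤ K) :
    restrictIdeal φ (induceIdeal φ I) ≤ K := by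
  obtain ⟨J, rfl⟩ := hK
  exact restrictIdeal_mono (induceIdeal_le_iff.2 h)

/-- The restricted closure `r(i(J))` of an ideal `J`. -/
def restrictedClosure (φ : A →⋆ₙₐ[ℂ] 𝓜(ℂ, B)) (J : ClosedIdeal A) : RestrictedIdeal φ :=
  ⟨restrictIdeal φ (induceIdeal φ J), induceIdeal φ J, rfl⟩

theorem restrictedClosure_le_iff {J : ClosedIdeal A} {K : RestrictedIdeal φ} :
    restrictedClosure φ J ≤ K ↔ J ≤ K.1 :=
  ⟨fun h => (le_restrictIdeal_induceIdeal J).trans h, restrictIdeal_induceIdeal_le K.2⟩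

/-- The common source of openness and surjectivity of `quasiOrbitProj`: the fibre over `p` meets
every open `U_J` that is not excluded by `J ≤ p`. -/
theorem exists_quasiOrbitProj_eq [FirstCountableTopology (RestrictedPrimeSpace φ)]
    (hJR : JoinsRestricted φ) (hC : ConditionC1 φ) (p : RestrictedPrimeSpace φ)
    {J : ClosedIdeal A} (hJ : ¬ J ≤ p.1.1) :
    ∃ P : PrimitiveIdealSpace A, ¬ J ≤ P.1 ∧ quasiOrbitProj hJR P = p := by
  obtain ⟨I, hI, hbasis⟩ := PrimeSpace.exists_countable_nhds_basis p
  obtain ⟨Q, hQ, hpQ, hJQ, hIQ⟩ := exists_isPrimitive_of_essential (P := p.1.1) (J := J)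
    (I := fun n => (I n).1) hJ fun n K hK h => by
      rw [inf_comm] at h
      -- Here `p` is prime only among restricted ideals, whereas `K` is arbitrary. Condition (C1)
      -- replaces `K` by its restricted closure without leaving `p`.
      have h1 := restrictIdeal_induceIdeal_le p.1.2 h
      rw [← hC _ _ (I n).2] at h1
      have h2 : I n ⊓ restrictedClosure φ K ≤ p.1 := by
        change (I n ⊓ restrictedClosure φ K).1 ≤ p.1.1
        rw [RestrictedIdeal.inf_val]
        exact h1
      exact (p.2.2 h2).elim (hI n) fun h3 => hK (restrictedClosure_le_iff.1 h3)
  refine ⟨⟨Q, hQ⟩, hJQ, Subtype.ext (le_antisymm ?_ ((le_largestRestricted_iff hJR _ _).2 hpQ))⟩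
  by_contra h
  obtain ⟨n, hn⟩ := hbasis _ h
  exact hn (quasiOrbitProj hJR ⟨Q, hQ⟩)
    (fun h2 => hIQ n ((le_largestRestricted_iff hJR _ _).1 h2)) le_rfl

theorem isOpenMap_quasiOrbitProj [FirstCountableTopology (RestrictedPrimeSpace φ)]
    (hJR : JoinsRestricted φ) (hC : ConditionC1 φ) : IsOpenMap (quasiOrbitProj hJR) := by
  rintro _ ⟨J, rfl⟩
  refine ⟨restrictedClosure φ J, Set.ext fun p => ⟨?_, fun h => ?_⟩⟩
  · rintro ⟨P, hP, rfl⟩ h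
    exact hP ((le_restrictIdeal_induceIdeal J).trans ((le_largestRestricted_iff hJR P _).1 h))
  · obtain ⟨P, hP, rfl⟩ := exists_quasiOrbitProj_eq hJR hC p
      fun hJp => h (restrictedClosure_le_iff.2 hJp)
    exact ⟨P, hP, rfl⟩

theorem surjective_quasiOrbitProj [FirstCountableTopology (RestrictedPrimeSpace φ)]
    (hJR : JoinsRestricted φ) (hC : ConditionC1 φ) :
    Function.Surjective (quasiOrbitProj hJR) := fun p => by
  obtain ⟨P, -, hP⟩ := exists_quasiOrbitProj_eq hJR hC p (J := ⊤) fun h =>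
    p.2.1 fun K _ => (le_top : K.1 ≤ ⊤).trans h
  exact ⟨P, hP⟩

theorem separatesIdeals_of_preimage {π : PrimitiveIdealSpace A → PrimitiveIdealSpace B}
    (hπ : ∀ J : ClosedIdeal B, (restrictIdeal φ J).toOpen = π ⁻¹' J.toOpen)
    (hsurj : Function.Surjective π) : SeparatesIdeals φ :=
  fun J₁ J₂ h => ClosedIdeal.toOpen_injective (hsurj.preimage_injective (by rw [← hπ, ← hπ, h]))

theorem joinsRestricted_of_preimage {π : PrimitiveIdealSpace A → PrimitiveIdealSpace B}
    (hπ : ∀ J : ClosedIdeal B, (restrictIdeal φ J).toOpen = π ⁻¹' J.toOpen) : JoinsRestricted φ := by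
  intro S hS
  refine ⟨sSup {J | restrictIdeal φ J ∈ S}, ClosedIdeal.toOpen_injective ?_⟩
  rw [hπ, ClosedIdeal.toOpen_sSup, ClosedIdeal.toOpen_sSup, Set.preimage_iUnion₂]
  ext P
  simp only [Set.mem_iUnion, exists_prop, ← hπ]
  constructor
  · rintro ⟨I, hI, hP⟩
    obtain ⟨J, rfl⟩ := hS I hI
    exact ⟨J, hI, hP⟩
  · rintro ⟨J, hJ, hP⟩
    exact ⟨_, hJ, hP⟩

/-- Direct image is left adjoint to preimage, as `i` is to `r`; left adjoints are unique. -/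
theorem toOpen_induceIdeal_of_preimage {π : PrimitiveIdealSpace A → PrimitiveIdealSpace B}
    (hπ : ∀ J : ClosedIdeal B, (restrictIdeal φ J).toOpen = π ⁻¹' J.toOpen)
    (hopen : IsOpenMap π) (I : ClosedIdeal A) :
    (induceIdeal φ I).toOpen = π '' I.toOpen := by
  obtain ⟨J, hJ⟩ := PrimitiveIdealSpace.isOpen_iff.1 (hopen _ I.isOpen_toOpen)
  have key : ∀ K : ClosedIdeal B, J ≤ K ↔ induceIdeal φ I ≤ K := fun K => by
    rw [induceIdeal_le_iff, ← ClosedIdeal.toOpen_subset_toOpen, ← ClosedIdeal.toOpen_subset_toOpen,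
      ← hJ, hπ, Set.image_subset_iff]
  rw [hJ, le_antisymm ((key _).2 le_rfl) ((key _).1 le_rfl)]

/-- Under the dictionary this is the projection formula `π(W ∩ π⁻¹(V)) = π(W) ∩ V`, pulled back
along `π`. -/
theorem conditionC1_of_preimage {π : PrimitiveIdealSpace A → PrimitiveIdealSpace B}
    (hπ : ∀ J : ClosedIdeal B, (restrictIdeal φ J).toOpen = π ⁻¹' J.toOpen)
    (hopen : IsOpenMap π) : ConditionC1 φ := by
  rintro _ J ⟨K, rfl⟩
  apply ClosedIdeal.toOpen_injective
  rw [ClosedIdeal.toOpen_inf, hπ, hπ, hπ, toOpen_induceIdeal_of_preimage hπ hopen,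
    toOpen_induceIdeal_of_preimage hπ hopen, ClosedIdeal.toOpen_inf, hπ, Set.image_preimage_inter,
    Set.preimage_inter]

end RestrictInduce

theorem corollary4p4 {A : Type u} {B : Type v} [NonUnitalCStarAlgebra A] [NonUnitalCStarAlgebra B]
    (φ : A →⋆ₙₐ[ℂ] 𝓜(ℂ, B)) (hfc : FirstCountableTopology (RestrictedPrimeSpace φ)) :
    ((∃ π : PrimitiveIdealSpace A → PrimitiveIdealSpace B,
        Continuous π ∧ IsOpenMap π ∧ Function.Surjective π ∧
        ∀ J : ClosedIdeal B, (restrictIdeal φ J).toOpen = π ⁻¹' J.toOpen) ↔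
      (SeparatesIdeals φ ∧ JoinsRestricted φ ∧ ConditionC1 φ)) ∧
    (SeparatesIdeals φ → ∀ hJR : JoinsRestricted φ, ConditionC1 φ →
      (∃ e : PrimitiveIdealSpace B ≃ₜ RestrictedPrimeSpace φ,
        ∀ Q : PrimitiveIdealSpace B, (e Q).1.1 = restrictIdeal φ Q.1) ∧
      (∃ f : QuasiOrbitSpace hJR ≃ₜ RestrictedPrimeSpace φ,
        ∀ P : PrimitiveIdealSpace A, f (Quotient.mk _ P) = quasiOrbitProj hJR P)) := by
  refine ⟨⟨?_, ?_⟩, fun hs hJR hC => ⟨exists_homeomorph_restrictedPrimeSpace hs, ?_⟩⟩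
  · rintro ⟨π, -, hopen, hsurj, hπ⟩
    exact ⟨separatesIdeals_of_preimage hπ hsurj, joinsRestricted_of_preimage hπ,
      conditionC1_of_preimage hπ hopen⟩
  · rintro ⟨hs, hJR, hC⟩
    obtain ⟨e, he⟩ := exists_homeomorph_restrictedPrimeSpace hs
    refine ⟨e.symm ∘ quasiOrbitProj hJR, e.symm.continuous.comp (continuous_quasiOrbitProj hJR),
      e.symm.isOpenMap.comp (isOpenMap_quasiOrbitProj hJR hC),
      e.symm.surjective.comp (surjective_quasiOrbitProj hJR hC), fun J => ?_⟩
    -- Both sides are preimages under `quasiOrbitProj`, so it suffices to compare open sets of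
    -- primes: `r(J) ≤ r(Q)` holds exactly when `J ≤ Q`.
    rw [← preimage_quasiOrbitProj hJR ⟨restrictIdeal φ J, J, rfl⟩, Set.preimage_comp]
    congr 1
    ext p
    obtain ⟨Q, rfl⟩ := e.surjective p
    rw [Set.mem_preimage, e.symm_apply_apply, ClosedIdeal.mem_toOpen]
    refine not_congr (Iff.trans (b := restrictIdeal φ J ≤ (e Q).1.1) Iff.rfl ?_)
    rw [he]
    exact ⟨fun h => hs.le_of_restrictIdeal_le h, fun h => restrictIdeal_mono h⟩
  · have hq : Topology.IsQuotientMap (quasiOrbitProj hJR) :=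
      (isOpenMap_quasiOrbitProj hJR hC).isQuotientMap (continuous_quasiOrbitProj hJR)
        (surjective_quasiOrbitProj hJR hC)
    exact ⟨hq.homeomorph (f := ⟨quasiOrbitProj hJR, continuous_quasiOrbitProj hJR⟩),
      fun P => rfl⟩
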